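/- Let $(T,m)$ be a probability space and let $(d_n)_{n\ge 1}$ be a sequence of non-negative integers (terms with $d_n=0$ contribute nothing, so that finite systems are included). Let $\varphi_n,\psi_n\in L_\infty(T,m;M_{d_n})$ be random complex $d_n\times d_n$ matrices, where $M_{d}$ carries the operator norm on $\mathbb C^d$ and $|x|=(x^*x)^{1/2}$. Assume $$\sup_n\|\varphi_n\|_{L_\infty(m;M_{d_n})}<\infty,\qquad \sup_n\|\psi_n\|_{L_\infty(m;M_{d_n})}<\infty,$$ and the normalized biorthogonality relation $$\int_T \varphi_n(i,j)\,\overline{\psi_{n'}(k,\ell)}\,dm=d_n^{-1}\,\delta_{n,n'}\,\delta_{i,k}\,\delta_{j,\ell}\qquad(n,n'\ge 1,\ 1\le i,j\le d_n,\ 1\le k,\ell\le d_{n'}).$$ Let $(g_n)_{n\ge1}$ be an independent sequence of random $d_n\times d_n$ matrices such that the variables $d_n^{1/2}g_n(i,j)$, $n\ge1$, $1\le i,j\le d_n$, are i.i.d. standard complex Gaussian variables (i.e. distributed as $2^{-1/2}(g'+ig'')$ with $g',g''$ independent standard real Gaussians). Suppose that $(\psi_n)$ is randomly Sidon: there is a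 constant $C$ such that for all $N\ge 1$ and all $x_n\in M_{d_n}$ ($n\le N$) $$\sum_{n=1}^N d_n\,\mathrm{tr}|x_n|\le C\;\mathbb E\,\Big\|\sum_{n=1}^N d_n\,\mathrm{tr}(x_n g_n\psi_n)\Big\|_{L_\infty(m)}.$$ Then $(\psi_n)$ is $\dot\otimes^k$-Sidon for every integer $k\ge 4$: for every $k\ge4$ there is a constant $\alpha$ such that for all $N\ge 1$ and all $x_n\in M_{d_n}$ ($n\le N$) $$\sum_{n=1}^N d_n\,\mathrm{tr}|x_n|\le \alpha\;\operatorname*{ess\,sup}_{(t_1,\dots,t_k)\in T^k}\Big|\sum_{n=1}^N d_n\,\mathrm{tr}\big(x_n\,\psi_n(t_1)\psi_n(t_2)\cdots\psi_n(t_k)\big)\Big|,$$ the essential supremum being taken with respect to the product measure $m^{\otimes k}$ on $T^k$. -/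

import Mathlib

open MeasureTheory ProbabilityTheory
open scoped ENNReal NNReal

noncomputable section

namespace MatSidon

section Matrices

open scoped MatrixOrder Matrix.Norms.L2Operator

/-- The trace norm `tr |x|` of a complex matrix, where `|x| = (x* x)^{1/2}`. -/
def traceNorm {d : ℕ} (x : Matrix (Fin d) (Fin d) ℂ) : ℝ :=
  (Matrix.trace (CFC.abs x)).re

/-- The norm of `M_d`: the operator norm of a matrix acting on the Euclidean space `ℂ^d`. -/
def opNorm {d : ℕ} (x : Matrix (Fin d) (Fin d) ℂ) : ℝ :=
  ‖Matrix.toEuclideanCLM (n := Fin d) (𝕜 := ℂ) x‖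

end Matrices

/-- The law of a centred complex Gaussian variable `v^{1/2} 2^{-1/2} (g' + i g'')`,
with `g'`, `g''` independent standard real Gaussians; the second absolute moment is `v`. -/
def complexGaussian (v : ℝ≥0) : Measure ℂ :=
  ((gaussianReal 0 (v / 2)).prod (gaussianReal 0 (v / 2))).map
    (fun p : ℝ × ℝ => (⟨p.1, p.2⟩ : ℂ))

instance (v : ℝ≥0) : IsProbabilityMeasure (complexGaussian v) :=
  Measure.isProbabilityMeasure_map
    (Complex.measurableEquivRealProd.symm.measurable.aemeasurable)

/-- The law of a `d × d` matrix with independent centred complex Gaussian entries whose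
second absolute moment is `1 / d`. -/
def gaussianMatrix (d : ℕ) : Measure (Fin d → Fin d → ℂ) :=
  Measure.pi fun _ => Measure.pi fun _ => complexGaussian (1 / (d : ℝ≥0))

instance (d : ℕ) : IsProbabilityMeasure (gaussianMatrix d) := by
  unfold gaussianMatrix; infer_instance

/-- The law `ℙ` of an independent sequence `(g_n)` of such random matrices, of sizes `d n`. The
random matrix `g_n` is the `n`-th coordinate on this product space. -/
def gaussianSystem (d : ℕ → ℕ) : Measure (∀ n, Fin (d n) → Fin (d n) → ℂ) :=
  Measure.infinitePi fun n => gaussianMatrix (d n)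

variable {T : Type*} [MeasurableSpace T]

/-- `φ_n ∈ L_∞(T, m; M_{d_n})` for all `n`, and `sup_n ‖φ_n‖_{L_∞(M_{d_n})} < ∞`. -/
def UniformlyBounded (m : Measure T) {d : ℕ → ℕ}
    (φ : ∀ n, T → Matrix (Fin (d n)) (Fin (d n)) ℂ) : Prop :=
  (∀ n i j, AEStronglyMeasurable (fun t => φ n t i j) m) ∧
    ∃ C' : ℝ, ∀ n, ∀ᵐ t ∂m, opNorm (φ n t) ≤ C'

/-- `∫ φ_n(i,j) conj(ψ_{n'}(k,l)) dm = d_n⁻¹ δ_{n,n'} δ_{i,k} δ_{j,l}`. -/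
def NormalizedBiorthogonal (m : Measure T) {d : ℕ → ℕ}
    (φ ψ : ∀ n, T → Matrix (Fin (d n)) (Fin (d n)) ℂ) : Prop :=
  (∀ n n', n ≠ n' → ∀ i j k l,
      ∫ t, φ n t i j * (starRingEnd ℂ) (ψ n' t k l) ∂m = 0) ∧
    ∀ n i j k l, ∫ t, φ n t i j * (starRingEnd ℂ) (ψ n t k l) ∂m =
      if i = k ∧ j = l then ((d n : ℂ))⁻¹ else 0

/-- `(φ_n)` is Sidon with constant `C`:
`∑_{k<N} d_k tr|x_k| ≤ C ‖∑_{k<N} d_k tr(x_k φ_k)‖_∞` for all `N` and all `x_k ∈ M_{d_k}`. -/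
def SidonWith (m : Measure T) {d : ℕ → ℕ}
    (φ : ∀ n, T → Matrix (Fin (d n)) (Fin (d n)) ℂ) (C : ℝ≥0) : Prop :=
  ∀ (N : ℕ) (x : ∀ n, Matrix (Fin (d n)) (Fin (d n)) ℂ),
    ENNReal.ofReal (∑ k ∈ Finset.range N, (d k : ℝ) * traceNorm (x k)) ≤
      C * eLpNorm (fun t => ∑ k ∈ Finset.range N, (d k : ℂ) * (x k * φ k t).trace) ∞ m

/-- `(φ_n)` is randomly Sidon with constant `C`:
`∑_{k<N} d_k tr|x_k| ≤ C 𝔼 ‖∑_{k<N} d_k tr(x_k g_k φ_k)‖_∞` for all `N` and all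
`x_k ∈ M_{d_k}`. -/
def RandomlySidonWith (m : Measure T) {d : ℕ → ℕ}
    (φ : ∀ n, T → Matrix (Fin (d n)) (Fin (d n)) ℂ) (C : ℝ≥0) : Prop :=
  ∀ (N : ℕ) (x : ∀ n, Matrix (Fin (d n)) (Fin (d n)) ℂ),
    ENNReal.ofReal (∑ k ∈ Finset.range N, (d k : ℝ) * traceNorm (x k)) ≤
      C * ∫⁻ g, eLpNorm (fun t => ∑ k ∈ Finset.range N,
        (d k : ℂ) * (x k * Matrix.of (g k) * φ k t).trace) ∞ m ∂(gaussianSystem d)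

/-- `(φ_n)` is randomly Sidon. -/
def RandomlySidon (m : Measure T) {d : ℕ → ℕ}
    (φ : ∀ n, T → Matrix (Fin (d n)) (Fin (d n)) ℂ) : Prop :=
  ∃ C : ℝ≥0, RandomlySidonWith m φ C

/-- The system `φ_n(t_1) φ_n(t_2) ⋯ φ_n(t_k)` on the `k`-fold product `T × ⋯ × T`. -/
def dotPower {d : ℕ → ℕ} (k : ℕ) (φ : ∀ n, T → Matrix (Fin (d n)) (Fin (d n)) ℂ) :
    ∀ n, (Fin k → T) → Matrix (Fin (d n)) (Fin (d n)) ℂ :=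
  fun n t => (List.ofFn fun j => φ n (t j)).prod

/-- `(φ_n)` is `⊗̇^k`-Sidon: the system `φ_n(t_1) ⋯ φ_n(t_k)` is Sidon, with some constant, on the
`k`-fold product probability space. -/
def DotTensorSidon (k : ℕ) (m : Measure T) {d : ℕ → ℕ}
    (φ : ∀ n, T → Matrix (Fin (d n)) (Fin (d n)) ℂ) : Prop :=
  ∃ C : ℝ≥0, SidonWith (Measure.pi fun _ : Fin k => m) (dotPower k φ) C

end MatSidon

end

/-! Write `S = ∑ d_n tr|x_n|` and let `M` bound the fourfold polynomial. By duality, the randomly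
Sidon property yields functionals `ℓ_X` in the unit ball of `L_∞(m)^*`, depending measurably on the
Gaussian point `X`, such that `H_n(X) = ℓ_X(ψ_n)` satisfies `∑ d_n tr|y_n| ≤ 2C Re ∑ d_n tr(y_n
𝔼(g_n H_n))` (`RandomlySidonWith.exists_norming`). Using this for `y_n = x_n`, which gives `H'` and
`w_n = tr(x_n 𝔼(g_n H'_n))`, and then for `y_n = (w_n/d_n) 1`, which gives `H`, one gets `S ≤ 4C² |∑
tr(𝔼 g_n H_n) w_n|`.

By biorthogonality (`NormalizedBiorthogonal.integral_sum_eq`) the last sum is the average over `s,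
s'` of `∑ d_n ∑ x_n(b,a) B(h_n(a,c), h'_n(c,b))`, where `h_n = ψ_n(s) H_n`, `h'_n = ψ_n(s') H'_n`
and `B(h,h') = ∑ d_n tr(𝔼(h g_n) φ_n(s)^* 𝔼(h' g_n) φ_n(s')^*)`. This form sees only the first
Wiener chaos and is bounded there, because the `φ_n` are.

Up to a small error `ε B` is integration against a measure. For a real contraction `α`, take
Gaussian pairs with cross-covariance `±εα`. Half the difference of their laws acts as `(Γ(εα) -
Γ(-εα))/2`, which is `ε^k Γ(α)` on odd chaoses and `0` on even ones: `ε` times the first chaos part,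
plus `O(ε³)` (`exists_couplings_approx`). Integration against the measures costs a multiple of
`M/ε`, since `ℓ_X` and `ℓ'_Y` act on slices of the polynomial. The error costs a multiple of `ε² S`,
free of dimension by trace duality (`norm_sum_meanForm_le`). A small `ε` absorbs it into `S/2`,
which settles `k = 4`.

The step from `k` to `k + 1` inserts `∫ φ_n^* ψ_n dm = 1` (`DotTensorSidon.succ`). -/

noncomputable section

namespace MatSidon

/-! ### Kernels that are power series in the inner product. -/

section PowerSeries

variable {ι : Type*} [Fintype ι]

/-- The sesquilinear form with kernel `A ⟪ξ, η⟫` on finitely supported families. -/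
def kernelForm (A : ℝ → ℝ) (c c' : EuclideanSpace ℝ ι →₀ ℂ) : ℂ :=
  ∑ ξ ∈ c.support, ∑ η ∈ c'.support, (starRingEnd ℂ) (c ξ) * c' η * (A (inner ℝ ξ η) : ℝ)

/-- The coefficients of `∑ c ξ • ξ^{⊗ k}`. -/
def tensorCoeff (k : ℕ) (c : EuclideanSpace ℝ ι →₀ ℂ) (p : Fin k → ι) : ℂ :=
  ∑ ξ ∈ c.support, c ξ * ((∏ i, ξ (p i) : ℝ) : ℂ)

lemma inner_pow_eq_sum (k : ℕ) (ξ η : EuclideanSpace ℝ ι) :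
    (inner ℝ ξ η) ^ k = ∑ p : Fin k → ι, (∏ i, ξ (p i)) * ∏ i, η (p i) := by
  classical
  have : inner ℝ ξ η = ∑ j, ξ j * η j := by
    simp [PiLp.inner_apply, mul_comm]
  rw [this, Fintype.sum_pow]
  simp [Finset.prod_mul_distrib]

lemma kernelForm_pow (k : ℕ) (c c' : EuclideanSpace ℝ ι →₀ ℂ) :
    kernelForm (fun s => s ^ k) c c' =
      ∑ p : Fin k → ι, (starRingEnd ℂ) (tensorCoeff k c p) * tensorCoeff k c' p := by
  simp only [kernelForm, tensorCoeff, inner_pow_eq_sum, map_sum, Finset.sum_mul_sum]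
  simp only [Complex.ofReal_sum, Finset.mul_sum]
  conv_rhs => rw [Finset.sum_comm]
  refine Finset.sum_congr rfl fun ξ _ => ?_
  conv_rhs => rw [Finset.sum_comm]
  refine Finset.sum_congr rfl fun η _ => Finset.sum_congr rfl fun p _ => ?_
  simp only [map_mul, Complex.conj_ofReal, Complex.ofReal_mul]
  ring

lemma kernelForm_pow_self (k : ℕ) (c : EuclideanSpace ℝ ι →₀ ℂ) :
    kernelForm (fun s => s ^ k) c c = ((∑ p : Fin k → ι, ‖tensorCoeff k c p‖ ^ 2 : ℝ) : ℂ) := by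
  rw [kernelForm_pow, Complex.ofReal_sum]
  refine Finset.sum_congr rfl fun p _ => ?_
  rw [Complex.conj_mul', Complex.ofReal_pow]

/-- The kernel `⟪ξ, η⟫^k` is the inner product of the tensor powers `ξ^{⊗k}` and `η^{⊗k}`, so this
is Cauchy–Schwarz followed by the arithmetic-geometric mean inequality. -/
lemma norm_kernelForm_pow_le (k : ℕ) (c c' : EuclideanSpace ℝ ι →₀ ℂ) :
    ‖kernelForm (fun s => s ^ k) c c'‖ ≤
      ((kernelForm (fun s => s ^ k) c c).re + (kernelForm (fun s => s ^ k) c' c').re) / 2 := by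
  rw [kernelForm_pow_self, kernelForm_pow_self, kernelForm_pow, Complex.ofReal_re,
    Complex.ofReal_re, ← Finset.sum_add_distrib, Finset.sum_div]
  refine (norm_sum_le _ _).trans (Finset.sum_le_sum fun p _ => ?_)
  rw [norm_mul, RCLike.norm_conj]
  nlinarith [sq_nonneg (‖tensorCoeff k c p‖ - ‖tensorCoeff k c' p‖)]

lemma hasSum_kernelForm {a : ℕ → ℝ} {A : ℝ → ℝ} (hA : ∀ s, HasSum (fun k => a k * s ^ k) (A s))
    (c c' : EuclideanSpace ℝ ι →₀ ℂ) :
    HasSum (fun k => (a k : ℂ) * kernelForm (fun s => s ^ k) c c') (kernelForm A c c') := by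
  have : (fun k => (a k : ℂ) * kernelForm (fun s => s ^ k) c c') = fun k =>
      ∑ ξ ∈ c.support, ∑ η ∈ c'.support, (starRingEnd ℂ) (c ξ) * c' η *
        ((a k * (inner ℝ ξ η) ^ k : ℝ) : ℂ) := by
    ext k
    simp only [kernelForm, Finset.mul_sum, Complex.ofReal_mul]
    refine Finset.sum_congr rfl fun ξ _ => Finset.sum_congr rfl fun η _ => by ring
  rw [this]
  exact hasSum_sum fun ξ _ => hasSum_sum fun η _ =>
    (Complex.hasSum_ofReal.2 (hA _)).mul_left _

lemma norm_kernelForm_le {a b : ℕ → ℝ} {A B : ℝ → ℝ}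
    (hA : ∀ s, HasSum (fun k => a k * s ^ k) (A s))
    (hB : ∀ s, HasSum (fun k => b k * s ^ k) (B s)) (hab : ∀ k, |b k| ≤ a k)
    (c c' : EuclideanSpace ℝ ι →₀ ℂ) :
    ‖kernelForm B c c'‖ ≤ ((kernelForm A c c).re + (kernelForm A c' c').re) / 2 := by
  have h1 := hasSum_kernelForm hB c c'
  have h2 : ∀ e : EuclideanSpace ℝ ι →₀ ℂ,
      HasSum (fun k => a k * (kernelForm (fun s => s ^ k) e e).re) (kernelForm A e e).re := by
    intro e
    simpa using Complex.hasSum_re (hasSum_kernelForm hA e e)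
  have h3 := ((h2 c).add (h2 c')).div_const 2
  rw [← h1.tsum_eq]
  refine tsum_of_norm_bounded h3 fun k => ?_
  rw [norm_mul, Complex.norm_real, Real.norm_eq_abs]
  calc _ ≤ a k * (((kernelForm (fun s => s ^ k) c c).re +
        (kernelForm (fun s => s ^ k) c' c').re) / 2) :=
        mul_le_mul (hab k) (norm_kernelForm_pow_le k c c') (norm_nonneg _)
          ((abs_nonneg _).trans (hab k))
    _ = _ := by ring

/-- The kernel is `sinh(εs) - εs`. Its coefficients `ε^k / k!`, over odd `k ≥ 3`, are dominated by
`ε³ / k!`, and domination of coefficients passes to the forms. -/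
lemma norm_kernelForm_odd_le {ε : ℝ} (h0 : 0 ≤ ε) (h1 : ε ≤ 1)
    (c c' : EuclideanSpace ℝ ι →₀ ℂ) :
    ‖kernelForm (fun s => (Real.exp (ε * s) - Real.exp (-(ε * s))) / 2 - ε * s) c c'‖ ≤
      ε ^ 3 * ((kernelForm Real.exp c c).re + (kernelForm Real.exp c' c').re) / 2 := by
  have hexp : ∀ s : ℝ, HasSum (fun k : ℕ => s ^ k / (k.factorial : ℝ)) (Real.exp s) := fun s => by
    rw [Real.exp_eq_exp_ℝ]; exact NormedSpace.expSeries_div_hasSum_exp s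
  have hA : ∀ s : ℝ, HasSum (fun k : ℕ => ε ^ 3 / (k.factorial : ℝ) * s ^ k)
      (ε ^ 3 * Real.exp s) := fun s => by
    refine ((hexp s).mul_left (ε ^ 3)).congr_fun fun k => ?_
    ring
  have hlin : ∀ s : ℝ, HasSum (fun k : ℕ => (if k = 1 then ε else 0) * s ^ k) (ε * s) := fun s => by
    convert hasSum_ite_eq (1 : ℕ) (ε * s) using 2 with k
    split_ifs with h <;> simp [h]
  have hB : ∀ s : ℝ, HasSum (fun k : ℕ =>
      ((ε ^ k - (-ε) ^ k) / 2 / (k.factorial : ℝ) - if k = 1 then ε else 0) * s ^ k)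
      ((Real.exp (ε * s) - Real.exp (-(ε * s))) / 2 - ε * s) := fun s => by
    refine ((((hexp (ε * s)).sub (hexp (-(ε * s)))).div_const 2).sub (hlin s)).congr_fun
      fun k => ?_
    rw [← neg_mul, mul_pow, mul_pow]
    ring
  refine (norm_kernelForm_le hA hB (fun k => ?_) c c').trans_eq ?_
  -- Even degrees cancel and degree `1` is subtracted; what remains has `k ≥ 3`, hence `ε^k ≤ ε³`.
  · rcases Nat.even_or_odd k with hk | hk
    · rw [hk.neg_pow, sub_self, if_neg (by rintro rfl; simp at hk)]
      simp only [zero_div, sub_self, abs_zero]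
      positivity
    · rw [hk.neg_pow]
      rcases eq_or_ne k 1 with rfl | hk1
      · simp [pow_nonneg h0]
      · have h3 : 3 ≤ k := by obtain ⟨r, rfl⟩ := hk; omega
        rw [if_neg hk1, sub_zero, abs_of_nonneg (by rw [sub_neg_eq_add]; positivity)]
        have : ε ^ k ≤ ε ^ 3 := pow_le_pow_of_le_one h0 h1 h3
        gcongr
        linarith
  · have : ∀ e : EuclideanSpace ℝ ι →₀ ℂ, kernelForm (fun s => ε ^ 3 * Real.exp s) e e =
        ((ε ^ 3 : ℝ) : ℂ) * kernelForm Real.exp e e := fun e => by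
      simp only [kernelForm, Finset.mul_sum]
      refine Finset.sum_congr rfl fun ξ _ => Finset.sum_congr rfl fun η _ => ?_
      rw [Complex.ofReal_mul]; ring
    rw [this, this, Complex.re_ofReal_mul, Complex.re_ofReal_mul]
    ring

end PowerSeries

/-! ### Gaussian pairs with prescribed cross-covariance. -/

section Coupling

open scoped Matrix RealInnerProductSpace

variable {ι : Type*} [Fintype ι]

/-- The bilinear form of `α` is bounded by `1` for the Euclidean norms. -/
def IsBilinContraction (α : Matrix ι ι ℝ) : Prop :=
  ∀ u v : EuclideanSpace ℝ ι, |u.ofLp ⬝ᵥ α *ᵥ v.ofLp| ≤ ‖u‖ * ‖v‖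

lemma IsBilinContraction.smul {α : Matrix ι ι ℝ} (hα : IsBilinContraction α) {ε : ℝ}
    (hε : |ε| ≤ 1) : IsBilinContraction (ε • α) := fun u v => by
  rw [Matrix.smul_mulVec, dotProduct_smul, smul_eq_mul, abs_mul]
  exact (mul_le_of_le_one_left (abs_nonneg _) hε).trans (hα u v)

/-- The quadratic form at `(u, v)` is at least `(‖u‖ - ‖v‖)²`. -/
lemma IsBilinContraction.posSemidef_fromBlocks [DecidableEq ι] {α : Matrix ι ι ℝ}
    (hα : IsBilinContraction α) : (Matrix.fromBlocks 1 α αᵀ 1).PosSemidef := by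
  refine .of_dotProduct_mulVec_nonneg ?_ fun x => ?_
  · simp [Matrix.IsHermitian, Matrix.fromBlocks_transpose]
  · have h := hα (WithLp.toLp 2 fun i => x (Sum.inl i)) (WithLp.toLp 2 fun i => x (Sum.inr i))
    have e : ∀ u : ι → ℝ, u ⬝ᵥ u = ‖WithLp.toLp 2 u‖ ^ 2 := fun u => by
      rw [EuclideanSpace.real_norm_sq_eq]; simp [dotProduct, sq]
    obtain ⟨u, v, rfl⟩ : ∃ u v : ι → ℝ, x = Sum.elim u v :=
      ⟨fun i => x (Sum.inl i), fun i => x (Sum.inr i), by ext (i | i) <;> rfl⟩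
    simp only [Sum.elim_inl, Sum.elim_inr] at h
    rw [star_trivial, Matrix.fromBlocks_mulVec, sumElim_dotProduct_sumElim]
    simp only [Sum.elim_comp_inl, Sum.elim_comp_inr, Matrix.one_mulVec, dotProduct_add, e]
    rw [Matrix.mulVec_transpose, dotProduct_comm v, ← Matrix.dotProduct_mulVec]
    nlinarith [abs_le.1 h, sq_nonneg (‖WithLp.toLp 2 u‖ - ‖WithLp.toLp 2 v‖)]

/-- The coupling is the centred Gaussian law whose covariance has blocks `1, α, αᵀ, 1`. The
marginals are read off its characteristic function by setting one argument to `0`. -/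
lemma exists_gaussian_coupling {α : Matrix ι ι ℝ} (hα : IsBilinContraction α) :
    ∃ π : Measure (EuclideanSpace ℝ ι × EuclideanSpace ℝ ι), IsProbabilityMeasure π ∧
      MeasurePreserving Prod.fst π (stdGaussian (EuclideanSpace ℝ ι)) ∧
      MeasurePreserving Prod.snd π (stdGaussian (EuclideanSpace ℝ ι)) ∧
      ∀ ξ η : EuclideanSpace ℝ ι,
        ∫ z, Complex.exp (((⟪z.1, ξ⟫ + ⟪z.2, η⟫ : ℝ) : ℂ) * Complex.I) ∂π =
          Complex.exp ((-(‖ξ‖ ^ 2 + ‖η‖ ^ 2) / 2 - ξ.ofLp ⬝ᵥ α *ᵥ η.ofLp : ℝ) : ℂ) := by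
  classical
  set μ := multivariateGaussian (0 : EuclideanSpace ℝ (ι ⊕ ι)) (Matrix.fromBlocks 1 α αᵀ 1)
  let Z : EuclideanSpace ℝ (ι ⊕ ι) → EuclideanSpace ℝ ι × EuclideanSpace ℝ ι := fun z =>
    (WithLp.toLp 2 fun i => z (Sum.inl i), WithLp.toLp 2 fun i => z (Sum.inr i))
  have hZ : Measurable Z := by fun_prop
  have key : ∀ ξ η : EuclideanSpace ℝ ι,
        ∫ z, Complex.exp (((⟪z.1, ξ⟫ + ⟪z.2, η⟫ : ℝ) : ℂ) * Complex.I) ∂(μ.map Z) =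
          Complex.exp ((-(‖ξ‖ ^ 2 + ‖η‖ ^ 2) / 2 - ξ.ofLp ⬝ᵥ α *ᵥ η.ofLp : ℝ) : ℂ) := by
    intro ξ η
    rw [integral_map hZ.aemeasurable (by fun_prop)]
    have h := charFun_multivariateGaussian (μ := (0 : EuclideanSpace ℝ (ι ⊕ ι)))
      hα.posSemidef_fromBlocks (WithLp.toLp 2 (Sum.elim ξ.ofLp η.ofLp))
    rw [charFun_apply] at h
    have e : ∀ u : EuclideanSpace ℝ ι, u.ofLp ⬝ᵥ u.ofLp = ‖u‖ ^ 2 := fun u => by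
      rw [EuclideanSpace.real_norm_sq_eq]; simp [dotProduct, sq]
    refine Eq.trans (integral_congr_ae (.of_forall fun z => ?_)) (h.trans ?_)
    · simp [Z, PiLp.inner_apply]
    · congr 1
      rw [inner_zero_right, Matrix.fromBlocks_mulVec, sumElim_dotProduct_sumElim]
      simp only [Sum.elim_comp_inl, Sum.elim_comp_inr, Matrix.one_mulVec, dotProduct_add, e]
      rw [Matrix.mulVec_transpose, dotProduct_comm η.ofLp, ← Matrix.dotProduct_mulVec]
      push_cast
      ring
  have hprob : IsProbabilityMeasure (μ.map Z) := Measure.isProbabilityMeasure_map hZ.aemeasurable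
  refine ⟨μ.map Z, hprob, ⟨measurable_fst, ?_⟩, ⟨measurable_snd, ?_⟩, key⟩
  · have := Measure.isProbabilityMeasure_map (μ := μ.map Z) measurable_fst.aemeasurable
    refine Measure.ext_of_charFun (funext fun ξ => ?_)
    rw [charFun_stdGaussian, charFun_apply, integral_map (by fun_prop) (by fun_prop)]
    have := key ξ 0
    simp only [inner_zero_right, add_zero] at this
    rw [this]
    simp
  · have := Measure.isProbabilityMeasure_map (μ := μ.map Z) measurable_snd.aemeasurable
    refine Measure.ext_of_charFun (funext fun ξ => ?_)
    rw [charFun_stdGaussian, charFun_apply, integral_map (by fun_prop) (by fun_prop)]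
    have := key 0 ξ
    simp only [inner_zero_right, zero_add] at this
    rw [this]
    simp

end Coupling

/-! ### Normalised exponentials on Gaussian space. -/

section GaussianExponentials

open scoped Matrix RealInnerProductSpace

variable {ι : Type*} [Fintype ι]

/-- The normalised exponential `exp (i⟪x, ξ⟫ + ‖ξ‖² / 2)`. -/
def gaussExp (ξ x : EuclideanSpace ℝ ι) : ℂ :=
  Complex.exp ((‖ξ‖ ^ 2 / 2 : ℝ) : ℂ) * Complex.exp ((⟪x, ξ⟫ : ℝ) * Complex.I)

@[fun_prop]
lemma continuous_gaussExp (ξ : EuclideanSpace ℝ ι) : Continuous (gaussExp ξ) := by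
  unfold gaussExp; fun_prop

lemma norm_gaussExp (ξ x : EuclideanSpace ℝ ι) :
    ‖gaussExp ξ x‖ = Real.exp (‖ξ‖ ^ 2 / 2) := by
  rw [gaussExp, norm_mul, Complex.norm_exp_ofReal_mul_I, mul_one, Complex.norm_exp_ofReal]

lemma memLp_gaussExp (ξ : EuclideanSpace ℝ ι) (p : ℝ≥0∞) :
    MemLp (gaussExp ξ) p (stdGaussian (EuclideanSpace ℝ ι)) :=
  MemLp.of_bound (continuous_gaussExp ξ).aestronglyMeasurable _
    (.of_forall fun x => (norm_gaussExp ξ x).le)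

lemma conj_gaussExp (ξ x : EuclideanSpace ℝ ι) :
    (starRingEnd ℂ) (gaussExp ξ x) = gaussExp (-ξ) x := by
  rw [gaussExp, gaussExp, map_mul, ← Complex.exp_conj, ← Complex.exp_conj, Complex.conj_ofReal]
  simp

/-- The class of `gaussExp ξ` in `L²`. -/
def gaussExpLp (ξ : EuclideanSpace ℝ ι) : Lp ℂ 2 (stdGaussian (EuclideanSpace ℝ ι)) :=
  (memLp_gaussExp ξ 2).toLp _

/-- Differentiate the characteristic function `exp(-‖ξ‖²/2)` in the direction of the `p`-th basis
vector. -/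
lemma integral_coord_mul_gaussExp (p : ι) (ξ : EuclideanSpace ℝ ι) :
    ∫ x, (x p : ℂ) * gaussExp ξ x ∂(stdGaussian (EuclideanSpace ℝ ι)) = Complex.I * ξ p := by
  classical
  set γ := stdGaussian (EuclideanSpace ℝ ι)
  have hint : MemLp id (1 : ℕ) γ := by simpa using IsGaussian.memLp_id γ 1 (by simp)
  have h := iteratedFDeriv_charFun (n := 1) (t := ξ) hint
    (fun _ => EuclideanSpace.single p (1 : ℝ))
  rw [iteratedFDeriv_one_apply] at h
  have h2 : HasFDerivAt (charFun γ) (Complex.exp ((-‖ξ‖ ^ 2 / 2 : ℝ) : ℂ) •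
      (Complex.ofRealCLM.comp (-(innerSL ℝ ξ)))) ξ := by
    have e : charFun γ = fun t : EuclideanSpace ℝ ι =>
        Complex.exp ((-‖t‖ ^ 2 / 2 : ℝ) : ℂ) := by
      ext t; rw [charFun_stdGaussian]; push_cast; rfl
    rw [e]
    have h3 : HasFDerivAt (fun t : EuclideanSpace ℝ ι => -‖t‖ ^ 2 / 2) (-(innerSL ℝ ξ)) ξ := by
      have := ((hasStrictFDerivAt_norm_sq ξ).hasFDerivAt.const_mul (-1 / 2 : ℝ))
      refine (this.congr_of_eventuallyEq (.of_forall fun t => by ring)).congr_fderiv ?_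
      ext t
      simp
      ring
    exact (Complex.ofRealCLM.hasFDerivAt.comp ξ h3).cexp
  rw [h2.fderiv] at h
  simp only [gaussExp]
  simp_rw [mul_left_comm _ (Complex.exp ((‖ξ‖ ^ 2 / 2 : ℝ) : ℂ))]
  rw [integral_const_mul]
  simp [EuclideanSpace.inner_single_right] at h
  rw [← mul_right_inj' Complex.I_ne_zero, mul_left_comm, ← h]
  have e : Complex.exp ((‖ξ‖ ^ 2 / 2 : ℝ) : ℂ) * Complex.exp (-(‖ξ‖ : ℂ) ^ 2 / 2) = 1 := by
    rw [← Complex.exp_add, ← Complex.exp_zero]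
    congr 1
    push_cast
    ring
  linear_combination (-(ξ p : ℂ)) * e - (ξ p : ℂ) * Complex.I_mul_I

end GaussianExponentials

/-! ### Characters separate integrable functions. -/

section Density

open scoped RealInnerProductSpace

variable {E : Type*} [NormedAddCommGroup E] [InnerProductSpace ℝ E] [CompleteSpace E]
  [MeasurableSpace E] [BorelSpace E] [SecondCountableTopology E]

/-- The finite measures with densities `r⁺` and `r⁻` have the same characteristic function, hence
coincide. -/
lemma ae_eq_zero_of_integral_char_eq_zero_real {μ : Measure E} [IsFiniteMeasure μ] {r : E → ℝ}
    (hr : Integrable r μ)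
    (h : ∀ ξ : E, ∫ x, Complex.exp ((⟪x, ξ⟫ : ℝ) * Complex.I) * (r x : ℂ) ∂μ = 0) :
    r =ᵐ[μ] 0 := by
  have key : ∀ s : E → ℝ, Integrable s μ →
      IsFiniteMeasure (μ.withDensity fun x => ENNReal.ofReal (s x)) ∧
      ∀ ξ, charFun (μ.withDensity fun x => ENNReal.ofReal (s x)) ξ =
        ∫ x, Complex.exp ((⟪x, ξ⟫ : ℝ) * Complex.I) * ((max (s x) 0 : ℝ) : ℂ) ∂μ := by
    intro s hs
    refine ⟨isFiniteMeasure_withDensity_ofReal hs.2, fun ξ => ?_⟩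
    rw [charFun_apply, integral_withDensity_eq_integral_toReal_smul₀
      hs.aemeasurable.ennreal_ofReal (.of_forall fun _ => ENNReal.ofReal_lt_top)]
    refine integral_congr_ae (.of_forall fun x => ?_)
    simp only [ENNReal.toReal_ofReal', Complex.real_smul]
    ring
  obtain ⟨h1, k1⟩ := key r hr
  obtain ⟨h2, k2⟩ := key _ hr.neg
  have hbd : ∀ (ξ : E) (s : E → ℝ), Integrable s μ →
      Integrable (fun x => Complex.exp ((⟪x, ξ⟫ : ℝ) * Complex.I) * ((s x : ℝ) : ℂ)) μ := by
    intro ξ s hs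
    refine hs.ofReal.bdd_mul (c := 1) (by fun_prop) (.of_forall fun x => ?_)
    rw [Complex.norm_exp_ofReal_mul_I]
  have heq : μ.withDensity (fun x => ENNReal.ofReal (r x)) =
      μ.withDensity (fun x => ENNReal.ofReal ((-r) x)) := by
    refine Measure.ext_of_charFun (funext fun ξ => ?_)
    rw [k1, k2, ← sub_eq_zero, ← integral_sub (hbd ξ _ hr.pos_part) (hbd ξ _ hr.neg.pos_part),
      ← h ξ]
    refine integral_congr_ae (.of_forall fun x => ?_)
    simp only [Pi.neg_apply]
    rw [← mul_sub, ← Complex.ofReal_sub]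
    congr 2
    rcases le_total 0 (r x) with hx | hx
    · rw [max_eq_left hx, max_eq_right (by linarith), sub_zero]
    · rw [max_eq_right hx, max_eq_left (by linarith)]; ring
  have := (withDensity_eq_iff hr.aemeasurable.ennreal_ofReal hr.neg.aemeasurable.ennreal_ofReal
    (hr.lintegral_lt_top).ne).1 heq
  filter_upwards [this] with x hx
  simp only [Pi.neg_apply] at hx
  rcases le_total 0 (r x) with h0 | h0
  · rw [ENNReal.ofReal_of_nonpos (p := -r x) (by linarith), ENNReal.ofReal_eq_zero] at hx
    exact le_antisymm hx h0
  · rw [ENNReal.ofReal_of_nonpos h0, eq_comm, ENNReal.ofReal_eq_zero] at hx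
    simp only [Pi.zero_apply]; linarith

/-- Conjugating the hypothesis at `-ξ` shows that it also holds for the conjugate of `f`, hence for
the real and imaginary parts. -/
lemma ae_eq_zero_of_integral_char_eq_zero {μ : Measure E} [IsFiniteMeasure μ] {f : E → ℂ}
    (hf : Integrable f μ)
    (h : ∀ ξ : E, ∫ x, Complex.exp ((⟪x, ξ⟫ : ℝ) * Complex.I) * f x ∂μ = 0) :
    f =ᵐ[μ] 0 := by
  have hbd : ∀ (ξ : E) (s : E → ℂ), Integrable s μ →
      Integrable (fun x => Complex.exp ((⟪x, ξ⟫ : ℝ) * Complex.I) * s x) μ := by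
    intro ξ s hs
    refine hs.bdd_mul (c := 1) (by fun_prop) (.of_forall fun x => ?_)
    rw [Complex.norm_exp_ofReal_mul_I]
  have hconj : Integrable (fun x => (starRingEnd ℂ) (f x)) μ :=
    (Complex.conjLIE.toContinuousLinearEquiv.integrable_comp_iff (φ := f)).2 hf
  have h' : ∀ ξ : E, ∫ x, Complex.exp ((⟪x, ξ⟫ : ℝ) * Complex.I) * (starRingEnd ℂ) (f x) ∂μ = 0 := by
    intro ξ
    rw [← map_zero (starRingEnd ℂ), ← h (-ξ), ← integral_conj]
    refine integral_congr_ae (.of_forall fun x => ?_)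
    simp only [map_mul, ← Complex.exp_conj, Complex.conj_I, Complex.conj_ofReal, inner_neg_right,
      Complex.ofReal_neg, map_neg, neg_mul_neg]
  have hre : (fun x => (f x).re) =ᵐ[μ] 0 := by
    refine ae_eq_zero_of_integral_char_eq_zero_real hf.re fun ξ => ?_
    have := congrArg₂ (· + ·) (h ξ) (h' ξ)
    simp only [← integral_add (hbd ξ _ hf) (hbd ξ _ hconj), add_zero] at this
    rw [← mul_right_inj' (two_ne_zero (α := ℂ)), mul_zero, ← integral_const_mul, ← this]
    refine integral_congr_ae (.of_forall fun x => ?_)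
    simp only
    rw [← mul_add, Complex.add_conj]
    push_cast; ring
  have him : (fun x => (f x).im) =ᵐ[μ] 0 := by
    refine ae_eq_zero_of_integral_char_eq_zero_real hf.im fun ξ => ?_
    have := congrArg₂ (· - ·) (h ξ) (h' ξ)
    simp only [← integral_sub (hbd ξ _ hf) (hbd ξ _ hconj), sub_zero] at this
    rw [← mul_right_inj' (mul_ne_zero (two_ne_zero (α := ℂ)) Complex.I_ne_zero), mul_zero,
      ← integral_const_mul, ← this]
    refine integral_congr_ae (.of_forall fun x => ?_)
    simp only
    rw [← mul_sub, Complex.sub_conj]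
    push_cast; ring
  filter_upwards [hre, him] with x h1 h2
  exact Complex.ext h1 h2

end Density

/-! ### The second quantization `Γ(α)` of a contraction. -/

section SecondQuantization

open scoped Matrix RealInnerProductSpace

variable {ι : Type*} [Fintype ι]

local notation "γ" => stdGaussian (EuclideanSpace ℝ ι)

lemma topologicalClosure_span_gaussExpLp :
    (Submodule.span ℂ (Set.range (gaussExpLp (ι := ι)))).topologicalClosure = ⊤ := by
  rw [Submodule.topologicalClosure_eq_top_iff, Submodule.eq_bot_iff]
  intro f hf
  rw [Submodule.mem_orthogonal] at hf
  have hfi : Integrable f γ := (Lp.memLp f).integrable (by norm_num)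
  rw [Lp.eq_zero_iff_ae_eq_zero]
  refine ae_eq_zero_of_integral_char_eq_zero hfi fun ξ => ?_
  have := hf _ (Submodule.subset_span ⟨-ξ, rfl⟩)
  rw [L2.inner_def] at this
  have h2 : ∫ x, Complex.exp ((‖ξ‖ ^ 2 / 2 : ℝ) : ℂ) *
      (Complex.exp ((⟪x, ξ⟫ : ℝ) * Complex.I) * f x) ∂γ = 0 := by
    rw [← this]
    refine integral_congr_ae ?_
    filter_upwards [(memLp_gaussExp (-ξ) 2).coeFn_toLp] with x hx
    rw [gaussExpLp, hx, RCLike.inner_apply, conj_gaussExp, neg_neg, gaussExp]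
    ring
  rw [integral_const_mul] at h2
  exact (mul_eq_zero.1 h2).resolve_left (Complex.exp_ne_zero _)

lemma inner_eq_zero_of_forall_gaussExpLp {f : Lp ℂ 2 γ} (h : ∀ ξ, inner ℂ (gaussExpLp ξ) f = 0) :
    f = 0 := by
  have := (Submodule.topologicalClosure_eq_top_iff).1 (topologicalClosure_span_gaussExpLp (ι := ι))
  rw [Submodule.eq_bot_iff] at this
  refine this f ((Submodule.mem_orthogonal _ _).2 fun u hu => ?_)
  induction hu using Submodule.span_induction with
  | mem x hx => obtain ⟨ξ, rfl⟩ := hx; exact h ξ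
  | zero => simp
  | add x y _ _ hx hy => rw [inner_add_left, hx, hy, add_zero]
  | smul a x _ hx => rw [inner_smul_left, hx, mul_zero]

lemma clm_ext_gaussExpLp {F : Type*} [NormedAddCommGroup F] [NormedSpace ℂ F]
    {S T : Lp ℂ 2 γ →L[ℂ] F} (h : ∀ ξ, S (gaussExpLp ξ) = T (gaussExpLp ξ)) : S = T := by
  refine ContinuousLinearMap.ext_on (s := Set.range (gaussExpLp (ι := ι))) ?_ ?_
  · rw [dense_iff_closure_eq, ← Submodule.topologicalClosure_coe,
      topologicalClosure_span_gaussExpLp]; rfl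
  · rintro _ ⟨ξ, rfl⟩; exact h ξ

lemma inner_toLp_mulVec (α : Matrix ι ι ℝ) (ξ η : EuclideanSpace ℝ ι) :
    ⟪ξ, WithLp.toLp 2 (α *ᵥ η.ofLp)⟫ = ξ.ofLp ⬝ᵥ α *ᵥ η.ofLp := by
  simp [PiLp.inner_apply, dotProduct, mul_comm]

/-- This exponential kernel turns operators determined on exponentials into power series kernels,
degree `k` being the `k`-th Wiener chaos. -/
lemma inner_gaussExpLp (ξ η : EuclideanSpace ℝ ι) :
    inner ℂ (gaussExpLp ξ) (gaussExpLp η) = (Real.exp ⟪ξ, η⟫ : ℂ) := by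
  have h := charFun_stdGaussian (E := EuclideanSpace ℝ ι) (η - ξ)
  rw [charFun_apply] at h
  rw [L2.inner_def]
  calc _ = ∫ x, Complex.exp ((‖ξ‖ ^ 2 / 2 + ‖η‖ ^ 2 / 2 : ℝ) : ℂ) *
        Complex.exp ((⟪x, η - ξ⟫ : ℝ) * Complex.I) ∂γ := by
        refine integral_congr_ae ?_
        filter_upwards [(memLp_gaussExp ξ 2).coeFn_toLp, (memLp_gaussExp η 2).coeFn_toLp]
          with x hx hy
        rw [gaussExpLp, gaussExpLp, hx, hy, RCLike.inner_apply, conj_gaussExp, gaussExp, gaussExp]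
        simp only [← Complex.exp_add, norm_neg, inner_neg_right, inner_sub_right]
        congr 1
        push_cast
        ring
    _ = _ := by
        rw [integral_const_mul, h, ← Complex.exp_add, Complex.ofReal_exp]
        congr 1
        have : ‖η - ξ‖ ^ 2 = ‖η‖ ^ 2 - 2 * ⟪η, ξ⟫ + ‖ξ‖ ^ 2 := norm_sub_sq_real η ξ
        rw [← Complex.ofReal_pow, this, real_inner_comm]
        push_cast
        ring

/-- With `U_X`, `U_Y` the isometries that pull a function back along the two marginals of the
coupling, `T = U_X^* U_Y`. It is a contraction by construction, and the characteristic function of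
the coupling gives its values on exponentials. -/
lemma exists_secondQuantization {α : Matrix ι ι ℝ} (hα : IsBilinContraction α) :
    ∃ (T : Lp ℂ 2 γ →L[ℂ] Lp ℂ 2 γ) (π : Measure (EuclideanSpace ℝ ι × EuclideanSpace ℝ ι))
      (_ : IsProbabilityMeasure π) (hX : MeasurePreserving Prod.fst π γ)
      (hY : MeasurePreserving Prod.snd π γ), (∀ f, ‖T f‖ ≤ ‖f‖) ∧
      (∀ η, T (gaussExpLp η) = gaussExpLp (WithLp.toLp 2 (α *ᵥ η.ofLp))) ∧
      ∀ f g, inner ℂ f (T g) = inner ℂ (Lp.compMeasurePreserving _ hX f)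
        (Lp.compMeasurePreserving _ hY g) := by
  obtain ⟨π, hπ, hX, hY, hchar⟩ := exists_gaussian_coupling hα
  let UX := (Lp.compMeasurePreservingₗᵢ ℂ (E := ℂ) (p := 2) _ hX).toContinuousLinearMap
  let UY := (Lp.compMeasurePreservingₗᵢ ℂ (E := ℂ) (p := 2) _ hY).toContinuousLinearMap
  have hT : ∀ f g, inner ℂ f ((UX.adjoint ∘L UY) g) = inner ℂ (Lp.compMeasurePreserving _ hX f)
        (Lp.compMeasurePreserving _ hY g) := fun f g => by
    rw [ContinuousLinearMap.comp_apply, ContinuousLinearMap.adjoint_inner_right]; rfl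
  refine ⟨UX.adjoint ∘L UY, π, hπ, hX, hY, fun f => ?_, fun η => ?_, hT⟩
  · have h1 : ‖UX.adjoint‖ ≤ 1 := by
      rw [LinearIsometryEquiv.norm_map]
      exact LinearIsometry.norm_toContinuousLinearMap_le _
    refine (UX.adjoint.le_of_opNorm_le h1 (UY f)).trans_eq ?_
    rw [one_mul]
    exact LinearIsometry.norm_map _ f
  · refine sub_eq_zero.1 (inner_eq_zero_of_forall_gaussExpLp fun ξ => ?_)
    rw [inner_sub_right, sub_eq_zero, inner_gaussExpLp, inner_toLp_mulVec, hT, L2.inner_def]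
    have h := hchar (-ξ) η
    calc _ = ∫ z, Complex.exp ((‖ξ‖ ^ 2 / 2 + ‖η‖ ^ 2 / 2 : ℝ) : ℂ) *
          Complex.exp (((⟪z.1, -ξ⟫ + ⟪z.2, η⟫ : ℝ) : ℂ) * Complex.I) ∂π := by
          refine integral_congr_ae ?_
          filter_upwards [((memLp_gaussExp ξ 2).comp_measurePreserving hX).coeFn_toLp,
            ((memLp_gaussExp η 2).comp_measurePreserving hY).coeFn_toLp] with z hx hy
          rw [gaussExpLp, gaussExpLp, Lp.toLp_compMeasurePreserving, Lp.toLp_compMeasurePreserving,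
            hx, hy, RCLike.inner_apply, Function.comp_apply, Function.comp_apply, conj_gaussExp,
            gaussExp, gaussExp]
          simp only [← Complex.exp_add, norm_neg]
          congr 1
          push_cast
          ring
      _ = _ := by
          rw [integral_const_mul, h, ← Complex.exp_add, Complex.ofReal_exp]
          congr 1
          simp only [norm_neg, WithLp.ofLp_neg, neg_dotProduct]
          push_cast
          ring

end SecondQuantization

/-! ### Isolating the first chaos by an odd combination. -/

section OddChaos

open scoped Matrix RealInnerProductSpace

variable {ι : Type*} [Fintype ι]

local notation "γ" => stdGaussian (EuclideanSpace ℝ ι)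

lemma memLp_coord (p : ι) : MemLp (fun x : EuclideanSpace ℝ ι => (x p : ℂ)) 2 γ := by
  have h : MemLp (fun x : EuclideanSpace ℝ ι => x p) 2 γ := by
    have := (EuclideanSpace.proj p : EuclideanSpace ℝ ι →L[ℝ] ℝ).comp_memLp'
      (IsGaussian.memLp_two_id (μ := γ))
    exact this
  exact h.ofReal

/-- The class of a coordinate function in `L²`. -/
def coordLp (p : ι) : Lp ℂ 2 γ := (memLp_coord p).toLp _

lemma inner_coordLp_toLp (p : ι) {f : EuclideanSpace ℝ ι → ℂ} (hf : MemLp f 2 γ) :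
    inner ℂ (coordLp p) (hf.toLp f) = ∫ x, (x p : ℂ) * f x ∂γ := by
  rw [L2.inner_def]
  refine integral_congr_ae ?_
  filter_upwards [(memLp_coord p).coeFn_toLp, hf.coeFn_toLp] with x hx hy
  rw [coordLp, hx, hy, RCLike.inner_apply, Complex.conj_ofReal, mul_comm]

lemma inner_coordLp_gaussExpLp (p : ι) (ξ : EuclideanSpace ℝ ι) :
    inner ℂ (coordLp p) (gaussExpLp ξ) = Complex.I * ξ p := by
  rw [gaussExpLp, inner_coordLp_toLp, integral_coord_mul_gaussExp]

lemma denseRange_linearCombination_gaussExpLp :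
    DenseRange (Finsupp.linearCombination ℂ (gaussExpLp (ι := ι))) := by
  rw [DenseRange, ← LinearMap.coe_range, Finsupp.range_linearCombination, dense_iff_closure_eq,
    ← Submodule.topologicalClosure_coe, topologicalClosure_span_gaussExpLp]
  rfl

/-- Sesquilinearity of `B` is taken as explicit hypotheses so that the lemma covers both the inner
product and the odd remainder form. -/
lemma inner_linearCombination_gaussExpLp {A : ℝ → ℝ} {B : Lp ℂ 2 γ → Lp ℂ 2 γ → ℂ}
    (hB : ∀ ξ η, B (gaussExpLp ξ) (gaussExpLp η) = (A ⟪ξ, η⟫ : ℝ))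
    (h1 : ∀ f g g', B f (g + g') = B f g + B f g') (h2 : ∀ f f' g, B (f + f') g = B f g + B f' g)
    (h3 : ∀ (a : ℂ) f g, B f (a • g) = a * B f g)
    (h4 : ∀ (a : ℂ) f g, B (a • f) g = (starRingEnd ℂ) a * B f g)
    (c c' : EuclideanSpace ℝ ι →₀ ℂ) :
    B (Finsupp.linearCombination ℂ gaussExpLp c) (Finsupp.linearCombination ℂ gaussExpLp c') =
      kernelForm A c c' := by
  have hz : ∀ f, B f 0 = 0 := fun f => by simpa using h3 0 f 0
  have hz' : ∀ g, B 0 g = 0 := fun g => by simpa using h4 0 0 g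
  have hs : ∀ f (s : Finset (EuclideanSpace ℝ ι)) (G : EuclideanSpace ℝ ι → Lp ℂ 2 γ),
      B f (∑ η ∈ s, G η) = ∑ η ∈ s, B f (G η) := fun f s G =>
    map_sum (AddMonoidHom.mk' (B f) (h1 f)) G s
  have hs' : ∀ g (s : Finset (EuclideanSpace ℝ ι)) (G : EuclideanSpace ℝ ι → Lp ℂ 2 γ),
      B (∑ η ∈ s, G η) g = ∑ η ∈ s, B (G η) g := fun g s G =>
    map_sum (AddMonoidHom.mk' (fun f => B f g) fun f f' => h2 f f' g) G s
  rw [Finsupp.linearCombination_apply, Finsupp.linearCombination_apply, Finsupp.sum, Finsupp.sum,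
    hs', kernelForm]
  refine Finset.sum_congr rfl fun ξ _ => ?_
  rw [hs]
  refine Finset.sum_congr rfl fun η _ => ?_
  rw [h3, h4, hB]
  ring

/-- On exponentials the form on the left has kernel `sinh(εs) - εs`, while the squared norms on the
right have kernel `exp`. The kernel estimate gives the bound on their span, and density extends it.
-/
lemma norm_odd_sub_linear_le {ε : ℝ} (h0 : 0 ≤ ε) (h1 : ε ≤ 1) {T S : Lp ℂ 2 γ →L[ℂ] Lp ℂ 2 γ}
    (hT : ∀ η, T (gaussExpLp η) = gaussExpLp (ε • η))
    (hS : ∀ η, S (gaussExpLp η) = gaussExpLp (-(ε • η))) (f g : Lp ℂ 2 γ) :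
    ‖(inner ℂ f (T g) - inner ℂ f (S g)) / 2 -
        ε * ∑ p, inner ℂ f (coordLp p) * inner ℂ (coordLp p) g‖ ≤
      ε ^ 3 * (‖f‖ ^ 2 + ‖g‖ ^ 2) / 2 := by
  refine isClosed_property2 (p := fun f g => ‖(inner ℂ f (T g) - inner ℂ f (S g)) / 2 -
        ε * ∑ p, inner ℂ f (coordLp p) * inner ℂ (coordLp p) g‖ ≤
      ε ^ 3 * (‖f‖ ^ 2 + ‖g‖ ^ 2) / 2) (denseRange_linearCombination_gaussExpLp (ι := ι)) ?_ ?_ f g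
  · exact isClosed_le (by fun_prop) (by fun_prop)
  · intro c c'
    have hn : ∀ c : EuclideanSpace ℝ ι →₀ ℂ,
        ‖Finsupp.linearCombination ℂ gaussExpLp c‖ ^ 2 = (kernelForm Real.exp c c).re := fun c => by
      rw [← inner_linearCombination_gaussExpLp (B := fun f g => inner ℂ f g) inner_gaussExpLp
        (fun _ _ _ => inner_add_right _ _ _) (fun _ _ _ => inner_add_left _ _ _)
        (fun _ _ _ => inner_smul_right _ _ _) (fun _ _ _ => inner_smul_left _ _ _)]
      exact (inner_self_eq_norm_sq (𝕜 := ℂ) _).symm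
    rw [hn, hn]
    refine le_of_eq_of_le ?_ (norm_kernelForm_odd_le h0 h1 c c')
    congr 1
    refine inner_linearCombination_gaussExpLp (B := fun f g =>
      (inner ℂ f (T g) - inner ℂ f (S g)) / 2 -
        ε * ∑ p, inner ℂ f (coordLp p) * inner ℂ (coordLp p) g) ?_ ?_ ?_ ?_ ?_ c c'
    · intro ξ η
      have e : ∀ p, inner ℂ (gaussExpLp ξ) (coordLp p) * inner ℂ (coordLp p) (gaussExpLp η) =
          ((ξ p * η p : ℝ) : ℂ) := fun p => by
        rw [← inner_conj_symm, inner_coordLp_gaussExpLp, inner_coordLp_gaussExpLp, map_mul,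
          Complex.conj_I, Complex.conj_ofReal, Complex.ofReal_mul]
        linear_combination -((ξ p : ℂ) * η p) * Complex.I_mul_I
      simp only [hT, hS, inner_gaussExpLp, e, inner_neg_right, inner_smul_right]
      rw [← Complex.ofReal_sum]
      have : ∑ p, ξ p * η p = ⟪ξ, η⟫ := by simp [PiLp.inner_apply, mul_comm]
      rw [this]
      push_cast
      rfl
    · intro f g g'
      simp only [map_add, inner_add_right, mul_add, Finset.sum_add_distrib]; ring
    · intro f f' g
      simp only [inner_add_left, add_mul, mul_add, Finset.sum_add_distrib]; ring
    · intro a f g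
      simp only [map_smul, inner_smul_right, mul_left_comm _ a, ← Finset.mul_sum]; ring
    · intro a f g
      simp only [inner_smul_left, mul_assoc, ← Finset.mul_sum]; ring

/-- An odd combination of two Gaussian couplings approximates the bilinear form with matrix `α`
on the first chaos. -/
theorem exists_couplings_approx {α : Matrix ι ι ℝ} (hα : IsBilinContraction α) {ε : ℝ}
    (h0 : 0 ≤ ε) (h1 : ε ≤ 1) :
    ∃ π₁ π₂ : Measure (EuclideanSpace ℝ ι × EuclideanSpace ℝ ι), IsProbabilityMeasure π₁ ∧
      IsProbabilityMeasure π₂ ∧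
      (∀ h h' : EuclideanSpace ℝ ι → ℂ, MemLp h 2 γ → MemLp h' 2 γ →
        Integrable (fun z => h z.1 * h' z.2) π₁ ∧ Integrable (fun z => h z.1 * h' z.2) π₂ ∧
        ‖(∫ z, h z.1 * h' z.2 ∂π₁ - ∫ z, h z.1 * h' z.2 ∂π₂) / 2 -
          ε * ∑ p, ∑ q, α p q * ((∫ x, (x p : ℂ) * h x ∂γ) * ∫ x, (x q : ℂ) * h' x ∂γ)‖ ≤
          ε ^ 3 * (∫ x, ‖h x‖ ^ 2 ∂γ + ∫ x, ‖h' x‖ ^ 2 ∂γ) / 2) := by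
  classical
  have hone : IsBilinContraction (1 : Matrix ι ι ℝ) := fun u v => by
    rw [Matrix.one_mulVec]
    have := abs_real_inner_le_norm v u
    simpa [PiLp.inner_apply, dotProduct, mul_comm] using this
  have hε : |ε| ≤ 1 := by rwa [abs_of_nonneg h0]
  have hε' : |-ε| ≤ 1 := by rwa [abs_neg]
  obtain ⟨P, -, -, -, -, -, hP, -⟩ := exists_secondQuantization (hone.smul hε)
  obtain ⟨Q, -, -, -, -, -, hQ, -⟩ := exists_secondQuantization (hone.smul hε')
  obtain ⟨T, -, -, -, -, hTn, hT, -⟩ := exists_secondQuantization hα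
  obtain ⟨R₁, π₁, i₁, X₁, Y₁, -, hR₁, hi₁⟩ := exists_secondQuantization (hα.smul hε)
  obtain ⟨R₂, π₂, i₂, X₂, Y₂, -, hR₂, hi₂⟩ := exists_secondQuantization (hα.smul hε')
  -- Functoriality: `Γ(εα) = Γ(ε) Γ(α)`. The odd estimate needs only the scalar case, applied to `f`
  -- and `Γ(α) g`.
  have e₁ : R₁ = P ∘L T := clm_ext_gaussExpLp fun ξ => by
    rw [ContinuousLinearMap.comp_apply, hT, hP, hR₁, Matrix.smul_mulVec, Matrix.smul_mulVec,
      Matrix.one_mulVec]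
  have e₂ : R₂ = Q ∘L T := clm_ext_gaussExpLp fun ξ => by
    rw [ContinuousLinearMap.comp_apply, hT, hQ, hR₂, Matrix.smul_mulVec, Matrix.smul_mulVec,
      Matrix.one_mulVec]
  -- On the first chaos `Γ(α)` acts through the matrix `α` itself.
  have hco : ∀ p (g : Lp ℂ 2 γ), inner ℂ (coordLp p) (T g) =
      ∑ q, α p q * inner ℂ (coordLp q) g := by
    intro p g
    have := clm_ext_gaussExpLp (S := (innerSL ℂ (coordLp p)) ∘L T)
      (T := ∑ q, (α p q : ℂ) • innerSL ℂ (coordLp q)) fun ξ => by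
        simp only [ContinuousLinearMap.comp_apply, hT, innerSL_apply_apply, inner_coordLp_gaussExpLp,
          _root_.sum_apply, _root_.smul_apply, smul_eq_mul,
          Matrix.mulVec, dotProduct, Complex.ofReal_sum, Finset.mul_sum, Complex.ofReal_mul]
        refine Finset.sum_congr rfl fun q _ => by ring
    have := congrArg (fun L => L g) this
    simpa using this
  refine ⟨π₁, π₂, i₁, i₂, fun h h' hh hh' => ?_⟩
  -- The first function is conjugated because the target is bilinear while the inner product is
  -- conjugate linear in its first argument.
  have hc : MemLp (fun x => (starRingEnd ℂ) (h x)) 2 γ := hh.star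
  have hint : ∀ {π : Measure (EuclideanSpace ℝ ι × EuclideanSpace ℝ ι)}
      (X : MeasurePreserving Prod.fst π γ) (Y : MeasurePreserving Prod.snd π γ),
      Integrable (fun z => h z.1 * h' z.2) π ∧ ∫ z, h z.1 * h' z.2 ∂π =
        inner ℂ (Lp.compMeasurePreserving _ X (hc.toLp _))
          (Lp.compMeasurePreserving _ Y (hh'.toLp _)) := fun {π} X Y => by
    refine ⟨(hh.comp_measurePreserving X).integrable_mul (hh'.comp_measurePreserving Y), ?_⟩
    rw [L2.inner_def]
    refine integral_congr_ae ?_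
    filter_upwards [(hc.comp_measurePreserving X).coeFn_toLp,
      (hh'.comp_measurePreserving Y).coeFn_toLp] with z hx hy
    rw [Lp.toLp_compMeasurePreserving, Lp.toLp_compMeasurePreserving, hx, hy, RCLike.inner_apply]
    simp [mul_comm]
  refine ⟨(hint X₁ Y₁).1, (hint X₂ Y₂).1, ?_⟩
  rw [(hint X₁ Y₁).2, (hint X₂ Y₂).2, ← hi₁, ← hi₂, e₁, e₂]
  have key := norm_odd_sub_linear_le h0 h1 (T := P) (S := Q)
    (fun η => by rw [hP, Matrix.smul_mulVec, Matrix.one_mulVec]; rfl)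
    (fun η => by rw [hQ, Matrix.smul_mulVec, Matrix.one_mulVec, ← neg_smul]; rfl)
    (hc.toLp _) (T (hh'.toLp _))
  have hnorm : ∀ {u : EuclideanSpace ℝ ι → ℂ} (hu : MemLp u 2 γ),
      ‖hu.toLp u‖ ^ 2 = ∫ x, ‖u x‖ ^ 2 ∂γ := fun {u} hu => by
    rw [← Complex.ofReal_inj, Complex.ofReal_pow]
    refine (inner_self_eq_norm_sq_to_K (𝕜 := ℂ) (hu.toLp u)).symm.trans ?_
    rw [L2.inner_def, ← integral_complex_ofReal]
    refine integral_congr_ae ?_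
    filter_upwards [hu.coeFn_toLp] with x hx
    rw [hx, inner_self_eq_norm_sq_to_K]
    push_cast; rfl
  have hlin : ∑ p, inner ℂ (hc.toLp _) (coordLp p) * inner ℂ (coordLp p) (T (hh'.toLp _)) =
      ∑ p, ∑ q, α p q * ((∫ x, (x p : ℂ) * h x ∂γ) * ∫ x, (x q : ℂ) * h' x ∂γ) := by
    refine Finset.sum_congr rfl fun p _ => ?_
    rw [hco, ← inner_conj_symm, inner_coordLp_toLp, Finset.mul_sum, ← integral_conj]
    refine Finset.sum_congr rfl fun q _ => ?_
    rw [inner_coordLp_toLp]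
    simp only [map_mul, Complex.conj_ofReal, Complex.conj_conj]
    ring
  rw [hlin] at key
  refine key.trans ?_
  have hT2 : ‖T (hh'.toLp _)‖ ^ 2 ≤ ‖hh'.toLp _‖ ^ 2 := by gcongr; exact hTn _
  have hf2 : ‖hc.toLp _‖ ^ 2 = ∫ x, ‖h x‖ ^ 2 ∂γ := by
    rw [hnorm]; simp only [RCLike.norm_conj]
  rw [hf2]
  rw [hnorm hh'] at hT2
  gcongr

end OddChaos

/-! ### Duality of trace norm and operator norm. -/

section TraceNorm

open scoped MatrixOrder Matrix.Norms.L2Operator Matrix ComplexOrder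

variable {d : ℕ}

lemma opNorm_eq_norm (x : Matrix (Fin d) (Fin d) ℂ) : opNorm x = ‖x‖ := rfl

lemma opNorm_nonneg (x : Matrix (Fin d) (Fin d) ℂ) : 0 ≤ opNorm x := norm_nonneg _

lemma opNorm_mul_le (x y : Matrix (Fin d) (Fin d) ℂ) : opNorm (x * y) ≤ opNorm x * opNorm y := by
  simp only [opNorm_eq_norm]; exact norm_mul_le x y

lemma opNorm_conjTranspose (x : Matrix (Fin d) (Fin d) ℂ) : opNorm xᴴ = opNorm x := by
  simp only [opNorm_eq_norm]; exact Matrix.l2_opNorm_conjTranspose x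

lemma opNorm_one_le : opNorm (1 : Matrix (Fin d) (Fin d) ℂ) ≤ 1 := by
  rw [opNorm, map_one]; exact ContinuousLinearMap.norm_id_le

lemma norm_toLp_mulVec_le (x : Matrix (Fin d) (Fin d) ℂ) (v : EuclideanSpace ℂ (Fin d)) :
    ‖WithLp.toLp 2 (x *ᵥ v.ofLp)‖ ≤ opNorm x * ‖v‖ :=
  (Matrix.toEuclideanCLM (n := Fin d) (𝕜 := ℂ) x).le_opNorm v

lemma norm_star_dotProduct_mulVec_le (x : Matrix (Fin d) (Fin d) ℂ)
    (u v : EuclideanSpace ℂ (Fin d)) :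
    ‖star u.ofLp ⬝ᵥ x *ᵥ v.ofLp‖ ≤ opNorm x * ‖u‖ * ‖v‖ := by
  have h : star u.ofLp ⬝ᵥ x *ᵥ v.ofLp = inner ℂ u (WithLp.toLp 2 (x *ᵥ v.ofLp)) := by
    rw [EuclideanSpace.inner_eq_star_dotProduct, dotProduct_comm]
  rw [h]
  calc _ ≤ ‖u‖ * ‖WithLp.toLp 2 (x *ᵥ v.ofLp)‖ := norm_inner_le_norm _ _
    _ ≤ ‖u‖ * (opNorm x * ‖v‖) := by gcongr; exact norm_toLp_mulVec_le x v
    _ = _ := by ring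

lemma opNorm_le_of_forall {x : Matrix (Fin d) (Fin d) ℂ} {c : ℝ} (hc : 0 ≤ c)
    (h : ∀ u v : EuclideanSpace ℂ (Fin d), ‖u‖ = 1 → ‖v‖ = 1 → ‖star u.ofLp ⬝ᵥ x *ᵥ v.ofLp‖ ≤ c) :
    opNorm x ≤ c := by
  refine ContinuousLinearMap.opNorm_le_of_unit_norm hc fun v hv => ?_
  rcases eq_or_ne (Matrix.toEuclideanCLM (n := Fin d) (𝕜 := ℂ) x v) 0 with h0 | h0
  · rw [h0, norm_zero]; exact hc
  set w := Matrix.toEuclideanCLM (n := Fin d) (𝕜 := ℂ) x v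
  have hw : ‖w‖ ≠ 0 := norm_ne_zero_iff.2 h0
  have := h (((‖w‖ : ℂ)⁻¹) • w) v (by rw [norm_smul, norm_inv, Complex.norm_real, norm_norm,
    inv_mul_cancel₀ hw]) hv
  have e : star (((‖w‖ : ℂ)⁻¹) • w).ofLp ⬝ᵥ x *ᵥ v.ofLp = inner ℂ (((‖w‖ : ℂ)⁻¹) • w) w := by
    rw [EuclideanSpace.inner_eq_star_dotProduct, dotProduct_comm]; rfl
  rw [e, inner_smul_left, norm_mul, inner_self_eq_norm_sq_to_K] at this
  simp only [RCLike.norm_conj, norm_inv, Complex.norm_real, norm_norm, norm_pow] at this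
  have h2 : ‖(RCLike.ofReal ‖w‖ : ℂ)‖ = ‖w‖ := by simp
  rw [h2, sq, ← mul_assoc, inv_mul_cancel₀ hw, one_mul] at this
  exact this

lemma norm_entry_le_opNorm (x : Matrix (Fin d) (Fin d) ℂ) (i j : Fin d) : ‖x i j‖ ≤ opNorm x := by
  have := norm_star_dotProduct_mulVec_le x (EuclideanSpace.single i 1) (EuclideanSpace.single j 1)
  simpa [← Pi.single_star] using this

lemma abs_isHermitian (x : Matrix (Fin d) (Fin d) ℂ) : (CFC.abs x).IsHermitian :=
  (CFC.abs_nonneg x).isSelfAdjoint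

lemma abs_posSemidef (x : Matrix (Fin d) (Fin d) ℂ) : (CFC.abs x).PosSemidef :=
  Matrix.nonneg_iff_posSemidef.1 (CFC.abs_nonneg x)

lemma traceNorm_eq_sum_eigenvalues (x : Matrix (Fin d) (Fin d) ℂ) :
    traceNorm x = ∑ i, (abs_isHermitian x).eigenvalues i := by
  rw [traceNorm, (abs_isHermitian x).trace_eq_sum_eigenvalues]
  simp

lemma trace_abs (x : Matrix (Fin d) (Fin d) ℂ) : (CFC.abs x).trace = traceNorm x := by
  rw [traceNorm_eq_sum_eigenvalues, (abs_isHermitian x).trace_eq_sum_eigenvalues]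
  simp

lemma traceNorm_nonneg (x : Matrix (Fin d) (Fin d) ℂ) : 0 ≤ traceNorm x := by
  rw [traceNorm_eq_sum_eigenvalues]
  exact Finset.sum_nonneg fun i _ => (abs_posSemidef x).eigenvalues_nonneg i

lemma trace_eq_sum_basis (b : OrthonormalBasis (Fin d) ℂ (EuclideanSpace ℂ (Fin d)))
    (x : Matrix (Fin d) (Fin d) ℂ) :
    x.trace = ∑ i, star (b i).ofLp ⬝ᵥ x *ᵥ (b i).ofLp := by
  have h := LinearMap.trace_eq_sum_inner (Matrix.toEuclideanLin x) b
  have h2 : LinearMap.trace ℂ _ (Matrix.toEuclideanLin x) = x.trace := by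
    rw [Matrix.toEuclideanLin_eq_toLin_orthonormal, Matrix.trace_toLin_eq]
  rw [← h2, h]
  refine Finset.sum_congr rfl fun i _ => ?_
  rw [EuclideanSpace.inner_eq_star_dotProduct, dotProduct_comm]; rfl

/-- Compute the trace in an orthonormal eigenbasis `b` of `|x|`: there `‖x b_i‖` is the eigenvalue
of `|x|` at `b_i`. -/
lemma norm_trace_mul_le (x w : Matrix (Fin d) (Fin d) ℂ) :
    ‖(x * w).trace‖ ≤ traceNorm x * opNorm w := by
  set hA := abs_isHermitian x
  set b := hA.eigenvectorBasis
  rw [Matrix.trace_mul_comm, trace_eq_sum_basis b, traceNorm_eq_sum_eigenvalues, Finset.sum_mul]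
  refine (norm_sum_le _ _).trans (Finset.sum_le_sum fun i _ => ?_)
  have hx : ‖WithLp.toLp 2 (x *ᵥ (b i).ofLp)‖ = hA.eigenvalues i := by
    have h0 : 0 ≤ hA.eigenvalues i := (abs_posSemidef x).eigenvalues_nonneg i
    rw [← sq_eq_sq₀ (norm_nonneg _) h0, ← Complex.ofReal_inj, Complex.ofReal_pow]
    refine (inner_self_eq_norm_sq_to_K (𝕜 := ℂ) (WithLp.toLp 2 (x *ᵥ (b i).ofLp))).symm.trans ?_
    rw [EuclideanSpace.inner_eq_star_dotProduct, dotProduct_comm, Matrix.star_mulVec,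
      ← Matrix.dotProduct_mulVec, Matrix.mulVec_mulVec, ← Matrix.star_eq_conjTranspose,
      ← CFC.abs_mul_abs x, ← Matrix.mulVec_mulVec, hA.mulVec_eigenvectorBasis,
      Matrix.mulVec_smul, hA.mulVec_eigenvectorBasis]
    have h1 : star (b i).ofLp ⬝ᵥ (b i).ofLp = 1 := by
      have := EuclideanSpace.inner_eq_star_dotProduct (b i) (b i)
      rw [dotProduct_comm, ← this, inner_self_eq_norm_sq_to_K, b.norm_eq_one]
      simp
    rw [dotProduct_smul, dotProduct_smul, h1]
    simp [sq]
  have := norm_star_dotProduct_mulVec_le w (b i) (WithLp.toLp 2 (x *ᵥ (b i).ofLp))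
  rw [hx, b.norm_eq_one, mul_one, mul_comm] at this
  rwa [← Matrix.mulVec_mulVec]

/-- Polar decomposition: `u = |x|⁻¹ x^*`, with a pseudo-inverse where `|x|` is singular. -/
lemma exists_trace_mul_eq_traceNorm (x : Matrix (Fin d) (Fin d) ℂ) :
    ∃ u : Matrix (Fin d) (Fin d) ℂ, opNorm u ≤ 1 ∧ (u * x).trace = traceNorm x := by
  set a := CFC.abs x
  have ha : IsSelfAdjoint a := (CFC.abs_nonneg x).isSelfAdjoint
  have hc : ∀ f : ℝ → ℝ, ContinuousOn f (spectrum ℝ a) := fun f =>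
    (Set.toFinite (spectrum ℝ a)).continuousOn f
  -- Since `0⁻¹ = 0`, this vanishes on the kernel of `|x|` and inverts `|x|` on its range.
  set q := cfc (fun t : ℝ => t⁻¹) a
  have hq : IsSelfAdjoint q := cfc_predicate _ _
  have hid : cfc (fun t : ℝ => t) a = a := cfc_id' ℝ a
  have h1 : q * (a * a) = a := by
    conv_lhs => rw [← hid]
    rw [← cfc_mul _ _ a (hc _) (hc _), ← cfc_mul _ _ a (hc _) (hc _)]
    conv_rhs => rw [← hid]
    refine cfc_congr fun t _ => ?_
    rcases eq_or_ne t 0 with rfl | ht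
    · simp
    · field_simp
  refine ⟨q * star x, ?_, ?_⟩
  -- `u u^*` is the spectral projection of `|x|` off `0`, so `‖u‖² ≤ 1`.
  · have h2 : (q * star x) * star (q * star x) = cfc (fun t : ℝ => t * t⁻¹) a := by
      rw [star_mul, star_star, hq.star_eq, mul_assoc, ← mul_assoc (star x), ← CFC.abs_mul_abs x,
        ← mul_assoc, h1]
      conv_lhs => rw [← hid]
      rw [← cfc_mul _ _ a (hc _) (hc _)]
    have h3 : ‖(q * star x) * star (q * star x)‖ ≤ 1 := by
      rw [h2]
      refine norm_cfc_le zero_le_one fun t _ => ?_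
      rcases eq_or_ne t 0 with rfl | ht
      · simp
      · simp [ht]
    rw [CStarRing.norm_self_mul_star] at h3
    rw [opNorm_eq_norm]
    nlinarith [norm_nonneg (q * star x)]
  · rw [mul_assoc, ← CFC.abs_mul_abs x, h1, trace_abs]

lemma norm_trace_le_traceNorm (x : Matrix (Fin d) (Fin d) ℂ) : ‖x.trace‖ ≤ traceNorm x := by
  have := norm_trace_mul_le x 1
  rw [mul_one] at this
  exact this.trans (mul_le_of_le_one_right (traceNorm_nonneg x) opNorm_one_le)

end TraceNorm

/-! ### Standard real coordinates of the Gaussian matrices. -/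

section GaussianCoordinates

/-- The real coordinates of the first `N` matrices of the Gaussian system. -/
abbrev CoordIndex (d : ℕ → ℕ) (N : ℕ) : Type :=
  Σ n : Fin N, (Fin (d n) × Fin (d n)) × Bool

/-- The normalised real coordinates of the first `N` matrices. -/
def realCoords (d : ℕ → ℕ) (N : ℕ) (g : ∀ n, Fin (d n) → Fin (d n) → ℂ) :
    CoordIndex d N → ℝ := fun p =>
  √(2 * d p.1) * if p.2.2 then (g p.1 p.2.1.1 p.2.1.2).re else (g p.1 p.2.1.1 p.2.1.2).im

/-- The Gaussian matrices as functions of their normalised real coordinates. -/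
def gMat {d : ℕ → ℕ} {N : ℕ} (X : EuclideanSpace ℝ (CoordIndex d N)) (n : Fin N) :
    Matrix (Fin (d n)) (Fin (d n)) ℂ :=
  Matrix.of fun i j => ((√(2 * d n))⁻¹ : ℝ) *
    ((X ⟨n, (i, j), true⟩ : ℂ) + Complex.I * (X ⟨n, (i, j), false⟩ : ℂ))

lemma measurable_realCoords (d : ℕ → ℕ) (N : ℕ) : Measurable (realCoords d N) := by
  refine measurable_pi_lambda _ fun p => ?_
  unfold realCoords
  split_ifs <;> fun_prop

lemma gMat_realCoords {d : ℕ → ℕ} {N : ℕ} (g : ∀ n, Fin (d n) → Fin (d n) → ℂ) (n : Fin N) :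
    gMat (WithLp.toLp 2 (realCoords d N g)) n = Matrix.of (g n) := by
  ext i j
  have hd : 0 < d n := i.pos
  have h : √(2 * d n : ℝ) ≠ 0 := by positivity
  simp only [gMat, realCoords, Matrix.of_apply, if_true, Bool.false_eq_true, if_false]
  rw [Complex.ofReal_mul, Complex.ofReal_mul, mul_left_comm Complex.I, ← mul_add, ← mul_assoc,
    ← Complex.ofReal_mul, inv_mul_cancel₀ h, Complex.ofReal_one, one_mul, mul_comm Complex.I,
    Complex.re_add_im]

/-- The real and imaginary parts are independent of variance `1/(2d)`, which the factor `√(2d)`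
normalises. -/
lemma complexGaussian_rectangle {d : ℕ} (hd : 0 < d) {s t : Set ℝ} (hs : MeasurableSet s)
    (ht : MeasurableSet t) :
    complexGaussian (1 / (d : ℝ≥0)) {z | √(2 * d) * z.re ∈ s ∧ √(2 * d) * z.im ∈ t} =
      gaussianReal 0 1 s * gaussianReal 0 1 t := by
  have hmap : (gaussianReal 0 (1 / (d : ℝ≥0) / 2)).map (√(2 * d) * ·) = gaussianReal 0 1 := by
    rw [gaussianReal_map_const_mul, mul_zero]
    congr 1
    ext
    have : (d : ℝ) ≠ 0 := by positivity
    push_cast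
    rw [Real.sq_sqrt (by positivity)]
    field_simp
  have hR : MeasurableSet {z : ℂ | √(2 * d) * z.re ∈ s ∧ √(2 * d) * z.im ∈ t} :=
    (measurableSet_preimage (f := fun z : ℂ => √(2 * d) * z.re) (by fun_prop) hs).inter
      (measurableSet_preimage (f := fun z : ℂ => √(2 * d) * z.im) (by fun_prop) ht)
  rw [complexGaussian, Measure.map_apply (show Measurable (fun p : ℝ × ℝ => (⟨p.1, p.2⟩ : ℂ)) from
    Complex.measurableEquivRealProd.symm.measurable) hR]
  have : (fun p : ℝ × ℝ => (⟨p.1, p.2⟩ : ℂ)) ⁻¹'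
      {z : ℂ | √(2 * d) * z.re ∈ s ∧ √(2 * d) * z.im ∈ t} =
      ((√(2 * d) * ·) ⁻¹' s) ×ˢ ((√(2 * d) * ·) ⁻¹' t) := rfl
  rw [this, Measure.prod_prod, ← Measure.map_apply (by fun_prop) hs,
    ← Measure.map_apply (by fun_prop) ht, hmap]

lemma map_realCoords (d : ℕ → ℕ) (N : ℕ) :
    (gaussianSystem d).map (realCoords d N) = Measure.pi fun _ => gaussianReal 0 1 := by
  symm
  refine Measure.pi_eq fun s hs => ?_
  rw [Measure.map_apply (measurable_realCoords d N) (.univ_pi hs)]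
  -- Preimages of boxes are cylinders: matrices of index at least `N` are unconstrained.
  let R : ∀ n, Fin (d n) → Fin (d n) → Set ℂ := fun n i j =>
    if h : n < N then {z | √(2 * d n) * z.re ∈ s ⟨⟨n, h⟩, (i, j), true⟩ ∧
      √(2 * d n) * z.im ∈ s ⟨⟨n, h⟩, (i, j), false⟩} else Set.univ
  have hpre : realCoords d N ⁻¹' (Set.univ.pi s) =
      Set.pi (Finset.range N : Set ℕ) fun n =>
        Set.univ.pi fun i => Set.univ.pi fun j => R n i j := by
    ext g
    simp only [Set.mem_preimage, Set.mem_pi, Set.mem_univ, true_implies, Finset.coe_range,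
      Set.mem_Iio]
    constructor
    · intro h n hn i j
      have h1 := h ⟨⟨n, hn⟩, (i, j), true⟩
      have h2 := h ⟨⟨n, hn⟩, (i, j), false⟩
      simp only [R, dif_pos hn]
      exact ⟨by simpa [realCoords] using h1, by simpa [realCoords] using h2⟩
    · rintro h ⟨n, ⟨i, j⟩, b⟩
      have := h n n.2 i j
      simp only [R, dif_pos n.2, Set.mem_ofPred_eq] at this
      cases b
      · simpa [realCoords] using this.2
      · simpa [realCoords] using this.1
  have hRm : ∀ n i j, MeasurableSet (R n i j) := by
    intro n i j
    by_cases hn : n < N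
    · simp only [R, dif_pos hn]
      exact (measurableSet_preimage (f := fun z : ℂ => √(2 * d n) * z.re) (by fun_prop) (hs _)).inter
        (measurableSet_preimage (f := fun z : ℂ => √(2 * d n) * z.im) (by fun_prop) (hs _))
    · simp only [R, dif_neg hn]; exact .univ
  rw [hpre, gaussianSystem, Measure.infinitePi_pi _ fun n _ =>
    .univ_pi fun i => .univ_pi fun j => hRm n i j, Finset.prod_range, Fintype.prod_sigma]
  refine Finset.prod_congr rfl fun n _ => ?_
  rw [gaussianMatrix, Measure.pi_pi, Fintype.prod_prod_type, Fintype.prod_prod_type]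
  refine Finset.prod_congr rfl fun i _ => ?_
  rw [Measure.pi_pi]
  refine Finset.prod_congr rfl fun j _ => ?_
  simp only [R, dif_pos n.2, Fintype.prod_bool]
  exact complexGaussian_rectangle i.pos (hs _) (hs _)

lemma map_toLp_realCoords (d : ℕ → ℕ) (N : ℕ) :
    (gaussianSystem d).map (fun g => WithLp.toLp 2 (realCoords d N g)) =
      stdGaussian (EuclideanSpace ℝ (CoordIndex d N)) := by
  rw [← map_pi_eq_stdGaussian, ← map_realCoords,
    Measure.map_map (by fun_prop) (measurable_realCoords d N)]
  rfl

end GaussianCoordinates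

/-! ### Measurable choice of almost norming functionals. -/

section Norming

/-- Norming functionals at a countable dense set of points suffice up to the factor `2`. Taking the
first one that works makes `ℓ` a function of a measurable integer index. -/
lemma exists_measurable_norming {K V : Type*} [TopologicalSpace K]
    [TopologicalSpace.SeparableSpace K] [Nonempty K] [MeasurableSpace K] [OpensMeasurableSpace K]
    [NormedAddCommGroup V] [NormedSpace ℂ V] {f : K → V} (hf : Continuous f) :
    ∃ ℓ : K → StrongDual ℂ V, (∀ k, ‖ℓ k‖ ≤ 1) ∧ (∀ v, Measurable fun k => ℓ k v) ∧
      ∀ k, ‖f k‖ ≤ 2 * (ℓ k (f k)).re := by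
  classical
  choose L hL1 hL2 using fun i : ℕ => exists_dual_vector'' ℂ (f (TopologicalSpace.denseSeq K i))
  let p : K → ℕ → Prop := fun k i => ‖f k‖ ≤ 2 * (L i (f k)).re
  have hp : ∀ k, ∃ i, p k i := by
    intro k
    rcases eq_or_ne (f k) 0 with h0 | h0
    · exact ⟨0, by simp [p, h0]⟩
    have hpos : 0 < ‖f k‖ := norm_pos_iff.2 h0
    -- For `w` this close to `f k`, `Re L(f k) ≥ ‖f k‖ - 2‖w - f k‖ ≥ (3/4) ‖f k‖`, which is more
    -- than the half required.
    have hU : IsOpen {k' | ‖f k' - f k‖ < ‖f k‖ / 8} := isOpen_lt (by fun_prop) (by fun_prop)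
    obtain ⟨_, hk', i, rfl⟩ := (TopologicalSpace.denseRange_denseSeq K).inter_open_nonempty _ hU
      ⟨k, by simpa using hpos⟩
    refine ⟨i, ?_⟩
    set w := f (TopologicalSpace.denseSeq K i)
    simp only [Set.mem_ofPred_eq] at hk'
    have h1 : ‖L i (w - f k)‖ ≤ ‖w - f k‖ := by
      simpa using (L i).le_of_opNorm_le (hL1 i) (w - f k)
    have h2 : (L i (f k)).re = ‖w‖ - (L i (w - f k)).re := by
      rw [map_sub, hL2]; simp [w]
    have h3 := (Complex.re_le_norm (L i (w - f k))).trans h1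
    have h4 : ‖f k‖ - ‖w - f k‖ ≤ ‖w‖ := by
      have := norm_sub_norm_le (f k) w
      rw [norm_sub_rev] at this; linarith
    simp only [p]
    linarith
  have hm : ∀ i, MeasurableSet {k | p k i} := fun i =>
    (isClosed_le (by fun_prop) (by fun_prop)).measurableSet
  refine ⟨fun k => L (Nat.find (hp k)), fun k => hL1 _, fun v => ?_, fun k => Nat.find_spec (hp k)⟩
  exact (measurable_from_top (f := fun i => L i v)).comp (measurable_find hp hm)

end Norming

/-! ### Dualising the randomly Sidon inequality. -/

section NormingRandomlySidon

open scoped Matrix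

lemma continuous_gMat {d : ℕ → ℕ} {N : ℕ} (n : Fin N) (i j : Fin (d n)) :
    Continuous fun X : EuclideanSpace ℝ (CoordIndex d N) => gMat X n i j := by
  simp only [gMat, Matrix.of_apply]
  fun_prop

lemma memLp_gMat {d : ℕ → ℕ} {N : ℕ} (n : Fin N) (i j : Fin (d n)) :
    MemLp (fun X : EuclideanSpace ℝ (CoordIndex d N) => gMat X n i j) 2
      (stdGaussian (EuclideanSpace ℝ (CoordIndex d N))) := by
  simp only [gMat, Matrix.of_apply]
  exact ((memLp_coord _).add ((memLp_coord _).const_mul _)).const_mul _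

variable {T : Type*} [MeasurableSpace T] {m : Measure T}

lemma norm_apply_le_of_ae_bound [IsProbabilityMeasure m] {ℓ : StrongDual ℂ (Lp ℂ ∞ m)}
    (hℓ : ‖ℓ‖ ≤ 1) {f : Lp ℂ ∞ m} {M : ℝ}
    (hM : 0 ≤ M) (hf : ∀ᵐ t ∂m, ‖f t‖ ≤ M) : ‖ℓ f‖ ≤ M := by
  have h1 : ‖f‖ ≤ M := by simpa using Lp.norm_le_of_ae_bound hM hf
  exact (ℓ.le_of_opNorm_le hℓ f).trans (by rwa [one_mul])

lemma norm_ennreal_ofReal_eq_eLpNorm (f : Lp ℂ ∞ m) : ENNReal.ofReal ‖f‖ = eLpNorm f ∞ m := by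
  rw [Lp.norm_def, ENNReal.ofReal_toReal (Lp.eLpNorm_ne_top f)]

variable {d : ℕ → ℕ} {ψ : ∀ n, T → Matrix (Fin (d n)) (Fin (d n)) ℂ}

lemma exists_entryLp (hψ : UniformlyBounded m ψ) :
    ∃ e : ∀ n, Fin (d n) → Fin (d n) → Lp ℂ ∞ m, ∀ n, ∀ᵐ t ∂m, ∀ i j, e n i j t = ψ n t i j := by
  obtain ⟨hm, C', hC'⟩ := hψ
  have hL : ∀ n i j, MemLp (fun t => ψ n t i j) ∞ m := fun n i j =>
    memLp_top_of_bound (hm n i j) C' (by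
      filter_upwards [hC' n] with t ht
      exact (norm_entry_le_opNorm _ _ _).trans ht)
  refine ⟨fun n i j => (hL n i j).toLp _, fun n => ?_⟩
  rw [ae_all_iff]; intro i; rw [ae_all_iff]; intro j
  exact (hL n i j).coeFn_toLp

lemma integrable_gMat_mul {N : ℕ}
    {ℓ : EuclideanSpace ℝ (CoordIndex d N) → StrongDual ℂ (Lp ℂ ∞ m)} (hℓ : ∀ X, ‖ℓ X‖ ≤ 1)
    (hm : ∀ v, Measurable fun X => ℓ X v) (n : Fin N) (i j : Fin (d n)) (v : Lp ℂ ∞ m) :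
    Integrable (fun X => gMat X n i j * ℓ X v)
      (stdGaussian (EuclideanSpace ℝ (CoordIndex d N))) := by
  refine ((memLp_gMat n i j).integrable (by norm_num)).mul_bdd (c := ‖v‖)
    (hm v).aestronglyMeasurable (.of_forall fun X => ?_)
  simpa using (ℓ X).le_of_opNorm_le (hℓ X) v

/-- The class of `t ↦ ∑ n, tr (a_n ψ_n(t))` in `L_∞`, in terms of the entries `e` of `ψ`. -/
def entryComb (e : ∀ n, Fin (d n) → Fin (d n) → Lp ℂ ∞ m) {N : ℕ}
    (a : ∀ n : Fin N, Matrix (Fin (d n)) (Fin (d n)) ℂ) : Lp ℂ ∞ m :=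
  ∑ n : Fin N, ∑ i, ∑ j, a n i j • e n j i

lemma coeFn_entryComb {e : ∀ n, Fin (d n) → Fin (d n) → Lp ℂ ∞ m}
    (he : ∀ n, ∀ᵐ t ∂m, ∀ i j, e n i j t = ψ n t i j) {N : ℕ}
    (a : ∀ n : Fin N, Matrix (Fin (d n)) (Fin (d n)) ℂ) :
    entryComb e a =ᵐ[m] fun t => ∑ n : Fin N, (a n * ψ n t).trace := by
  have hs : ∀ {κ : Type} (s : Finset κ) (F : κ → Lp ℂ ∞ m) (G : κ → T → ℂ),
      (∀ k, F k =ᵐ[m] G k) → (∑ k ∈ s, F k : Lp ℂ ∞ m) =ᵐ[m] fun t => ∑ k ∈ s, G k t := by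
    intro κ s F G hFG
    classical
    induction s using Finset.induction_on with
    | empty => exact Lp.coeFn_zero ℂ ∞ m
    | insert k s hk ih =>
      rw [Finset.sum_insert hk]
      filter_upwards [Lp.coeFn_add (F k) (∑ k ∈ s, F k), hFG k, ih] with t h1 h2 h3
      rw [h1, Pi.add_apply, h2, h3, Finset.sum_insert hk]
  refine hs _ _ (fun n t => (a n * ψ n t).trace) fun n => ?_
  simp only [Matrix.trace, Matrix.diag, Matrix.mul_apply]
  refine hs _ _ (fun i t => ∑ j, a n i j * ψ n t j i) fun i => hs _ _ (fun j t => _) fun j => ?_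
  filter_upwards [Lp.coeFn_smul (a n i j) (e n j i), he n] with t h1 h2
  rw [h1, Pi.smul_apply, h2, smul_eq_mul]

/-- The matrices of the values of a functional on the entries of `ψ`. -/
def dualMat (e : ∀ n, Fin (d n) → Fin (d n) → Lp ℂ ∞ m) (ℓ : StrongDual ℂ (Lp ℂ ∞ m)) (n : ℕ) :
    Matrix (Fin (d n)) (Fin (d n)) ℂ :=
  Matrix.of fun i j => ℓ (e n i j)

lemma apply_entryComb (e : ∀ n, Fin (d n) → Fin (d n) → Lp ℂ ∞ m) {N : ℕ}
    (a : ∀ n : Fin N, Matrix (Fin (d n)) (Fin (d n)) ℂ) (ℓ : StrongDual ℂ (Lp ℂ ∞ m)) :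
    ℓ (entryComb e a) = ∑ n : Fin N, (a n * dualMat e ℓ n).trace := by
  simp [entryComb, dualMat, Matrix.trace, Matrix.mul_apply]

/-- The dual form of the randomly Sidon property. -/
lemma RandomlySidonWith.exists_norming {C : ℝ≥0} (h : RandomlySidonWith m ψ C)
    {e : ∀ n, Fin (d n) → Fin (d n) → Lp ℂ ∞ m}
    (he : ∀ n, ∀ᵐ t ∂m, ∀ i j, e n i j t = ψ n t i j) (N : ℕ)
    (x : ∀ n : Fin N, Matrix (Fin (d n)) (Fin (d n)) ℂ) :
    ∃ ℓ : EuclideanSpace ℝ (CoordIndex d N) → StrongDual ℂ (Lp ℂ ∞ m),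
      (∀ X, ‖ℓ X‖ ≤ 1) ∧ (∀ v, Measurable fun X => ℓ X v) ∧
      ∑ n : Fin N, (d n : ℝ) * traceNorm (x n) ≤
        2 * C * (∑ n : Fin N, (d n : ℂ) * ∑ a, ∑ i, ∑ k, x n a i *
          ∫ X, gMat X n i k * ℓ X (e n k a)
            ∂(stdGaussian (EuclideanSpace ℝ (CoordIndex d N)))).re := by
  classical
  set γ := stdGaussian (EuclideanSpace ℝ (CoordIndex d N))
  let V : EuclideanSpace ℝ (CoordIndex d N) → Lp ℂ ∞ m := fun X =>
    entryComb e fun n => (d n : ℂ) • (x n * gMat X n)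
  have hVX : ∀ X, V X = ∑ n : Fin N, (d n : ℂ) • ∑ a, ∑ i, ∑ k,
      (x n a i * gMat X n i k) • e n k a := by
    intro X
    simp only [V, entryComb, Matrix.smul_apply, Matrix.mul_apply, smul_eq_mul, Finset.mul_sum,
      Finset.sum_smul, Finset.smul_sum, smul_smul]
    refine Finset.sum_congr rfl fun n _ => Finset.sum_congr rfl fun a _ => Finset.sum_comm
  have hV : Continuous V := by
    have := continuous_gMat (d := d) (N := N)
    rw [funext hVX]
    fun_prop
  obtain ⟨ℓ, hℓ, hm, hn⟩ := exists_measurable_norming hV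
  refine ⟨ℓ, hℓ, hm, ?_⟩
  have hVint : Integrable (fun X => ‖V X‖) γ := by
    refine Integrable.mono' (g := fun X => ∑ n : Fin N, ∑ a, ∑ i, ∑ k,
      ‖(d n : ℂ) * x n a i‖ * ‖e n k a‖ * ‖gMat X n i k‖) ?_ hV.norm.aestronglyMeasurable
      (.of_forall fun X => ?_)
    · refine integrable_finsetSum _ fun n _ => integrable_finsetSum _ fun a _ =>
        integrable_finsetSum _ fun i _ => integrable_finsetSum _ fun k _ =>
        (((memLp_gMat n i k).integrable (by norm_num)).norm.const_mul _)
    · rw [norm_norm]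
      simp only [hVX, Finset.smul_sum, smul_smul]
      refine (norm_sum_le _ _).trans (Finset.sum_le_sum fun n _ => ?_)
      refine (norm_sum_le _ _).trans (Finset.sum_le_sum fun a _ => ?_)
      refine (norm_sum_le _ _).trans (Finset.sum_le_sum fun i _ => ?_)
      refine (norm_sum_le _ _).trans (Finset.sum_le_sum fun k _ => ?_)
      rw [norm_smul, ← mul_assoc, norm_mul]
      exact le_of_eq (by ring)
  have hVeq : ∀ g : ∀ n, Fin (d n) → Fin (d n) → ℂ,
      eLpNorm (fun t => ∑ n : Fin N, (d n : ℂ) * (x n * Matrix.of (g n) * ψ n t).trace) ∞ m =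
        ENNReal.ofReal ‖V (WithLp.toLp 2 (realCoords d N g))‖ := by
    intro g
    rw [norm_ennreal_ofReal_eq_eLpNorm]
    refine eLpNorm_congr_ae ?_
    filter_upwards [coeFn_entryComb he fun n : Fin N =>
      (d n : ℂ) • (x n * gMat (WithLp.toLp 2 (realCoords d N g)) n)] with t ht
    rw [ht]
    simp only [gMat_realCoords, Matrix.smul_mul, Matrix.trace_smul, smul_eq_mul]
  have h1 : ENNReal.ofReal (∑ n : Fin N, (d n : ℝ) * traceNorm (x n)) ≤
      C * ∫⁻ X, ENNReal.ofReal ‖V X‖ ∂γ := by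
    -- The finite family is extended by `0`; only indices below `N` enter the inequality.
    have := h N fun n => if hn : n < N then x ⟨n, hn⟩ else 0
    simp only [Finset.sum_range, Fin.is_lt, dif_pos, Fin.eta, hVeq] at this
    refine this.trans_eq ?_
    have hmeas : Measurable fun g : ∀ n, Fin (d n) → Fin (d n) → ℂ =>
        WithLp.toLp 2 (realCoords d N g) :=
      (WithLp.measurable_toLp 2 _).comp (measurable_realCoords d N)
    rw [show γ = _ from (map_toLp_realCoords d N).symm, lintegral_map
      (f := fun X => ENNReal.ofReal ‖V X‖) hV.norm.measurable.ennreal_ofReal hmeas]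
  rw [← ofReal_integral_eq_lintegral_ofReal hVint (.of_forall fun _ => norm_nonneg _),
    ← ENNReal.ofReal_coe_nnreal, ← ENNReal.ofReal_mul C.coe_nonneg, ENNReal.ofReal_le_ofReal_iff
    (mul_nonneg C.coe_nonneg (integral_nonneg fun _ => norm_nonneg _))] at h1
  refine h1.trans ?_
  rw [mul_comm 2 (C : ℝ), mul_assoc]
  refine mul_le_mul_of_nonneg_left ?_ C.coe_nonneg
  have hi := integrable_gMat_mul (N := N) hℓ hm
  have hℓV : ∀ X, ℓ X (V X) = ∑ n : Fin N, (d n : ℂ) * ∑ a, ∑ i, ∑ k,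
      x n a i * (gMat X n i k * ℓ X (e n k a)) := fun X => by
    simp only [hVX, map_sum, map_smul, smul_eq_mul, mul_assoc]
  have hi2 : Integrable (fun X => ℓ X (V X)) γ := by
    simp only [hℓV]
    exact integrable_finsetSum _ fun n _ => (integrable_finsetSum _ fun a _ =>
        integrable_finsetSum _ fun i _ => integrable_finsetSum _ fun k _ =>
        (hi n i k _).const_mul _).const_mul _
  have hsum : ∫ X, ℓ X (V X) ∂γ = ∑ n : Fin N, (d n : ℂ) * ∑ a, ∑ i, ∑ k, x n a i *
          ∫ X, gMat X n i k * ℓ X (e n k a) ∂γ := by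
    simp only [hℓV]
    rw [integral_finsetSum _ fun n _ => (integrable_finsetSum _ fun a _ =>
        integrable_finsetSum _ fun i _ => integrable_finsetSum _ fun k _ =>
        (hi n i k _).const_mul _).const_mul _]
    refine Finset.sum_congr rfl fun n _ => ?_
    rw [integral_const_mul, integral_finsetSum _ fun a _ =>
        integrable_finsetSum _ fun i _ => integrable_finsetSum _ fun k _ =>
        (hi n i k _).const_mul _]
    congr 1
    refine Finset.sum_congr rfl fun a _ => ?_
    rw [integral_finsetSum _ fun i _ => integrable_finsetSum _ fun k _ =>
        (hi n i k _).const_mul _]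
    refine Finset.sum_congr rfl fun i _ => ?_
    rw [integral_finsetSum _ fun k _ => (hi n i k _).const_mul _]
    refine Finset.sum_congr rfl fun k _ => ?_
    rw [integral_const_mul]
  rw [← hsum]
  have : (∫ X, ℓ X (V X) ∂γ).re = ∫ X, (ℓ X (V X)).re ∂γ := (integral_re hi2).symm
  rw [this, ← integral_const_mul]
  exact integral_mono hVint (hi2.re.const_mul 2) hn

end NormingRandomlySidon

/-! ### Hilbert–Schmidt estimates. -/

section FrobeniusBounds

open scoped Matrix

variable {d : ℕ}

/-- The square of the Frobenius norm. -/
def frobSq (x : Matrix (Fin d) (Fin d) ℂ) : ℝ := ∑ i, ∑ j, ‖x i j‖ ^ 2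

lemma frobSq_nonneg (x : Matrix (Fin d) (Fin d) ℂ) : 0 ≤ frobSq x := by
  unfold frobSq; positivity

lemma frobSq_conjTranspose (x : Matrix (Fin d) (Fin d) ℂ) : frobSq xᴴ = frobSq x := by
  rw [frobSq, frobSq, Finset.sum_comm]
  simp [Matrix.conjTranspose_apply]

lemma sum_norm_sq_mulVec_le (x : Matrix (Fin d) (Fin d) ℂ) (v : Fin d → ℂ) :
    ∑ i, ‖(x *ᵥ v) i‖ ^ 2 ≤ opNorm x ^ 2 * ∑ i, ‖v i‖ ^ 2 := by
  have h := norm_toLp_mulVec_le x (WithLp.toLp 2 v)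
  have h2 := pow_le_pow_left₀ (norm_nonneg _) h 2
  rwa [mul_pow, EuclideanSpace.norm_sq_eq, EuclideanSpace.norm_sq_eq] at h2

lemma frobSq_mul_le (x y : Matrix (Fin d) (Fin d) ℂ) :
    frobSq (x * y) ≤ opNorm x ^ 2 * frobSq y := by
  rw [frobSq, frobSq, Finset.sum_comm, Finset.sum_comm (f := fun i j => ‖y i j‖ ^ 2),
    Finset.mul_sum]
  refine Finset.sum_le_sum fun j _ => ?_
  exact sum_norm_sq_mulVec_le x fun i => y i j

lemma frobSq_mul_mul_le (x y z : Matrix (Fin d) (Fin d) ℂ) :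
    frobSq (x * y * z) ≤ opNorm x ^ 2 * opNorm z ^ 2 * frobSq y := by
  rw [mul_assoc, mul_assoc]
  refine (frobSq_mul_le _ _).trans (mul_le_mul_of_nonneg_left ?_ (sq_nonneg _))
  rw [← frobSq_conjTranspose, Matrix.conjTranspose_mul, ← frobSq_conjTranspose y,
    ← opNorm_conjTranspose z]
  exact frobSq_mul_le _ _

lemma norm_trace_mul_le_frobSq (x y : Matrix (Fin d) (Fin d) ℂ) :
    ‖(x * y).trace‖ ≤ √(frobSq x) * √(frobSq y) := by
  have h1 : ‖(x * y).trace‖ ≤ ∑ q : Fin d × Fin d, ‖x q.1 q.2‖ * ‖y q.2 q.1‖ := by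
    rw [Fintype.sum_prod_type]
    refine (norm_sum_le _ _).trans (Finset.sum_le_sum fun i _ => ?_)
    rw [Matrix.diag_apply, Matrix.mul_apply]
    refine (norm_sum_le _ _).trans (Finset.sum_le_sum fun j _ => (norm_mul _ _).le)
  refine h1.trans ((Real.sum_mul_le_sqrt_mul_sqrt _ _ _).trans_eq ?_)
  rw [Fintype.sum_prod_type, Fintype.sum_prod_type, Finset.sum_comm (f := fun i j => ‖y j i‖ ^ 2)]
  rfl

end FrobeniusBounds

/-! ### Dimension-free control of the remainder. -/

section SquareIntegrable

open scoped Matrix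

variable {ι : Type*} [Fintype ι]

local notation "γ" => stdGaussian (EuclideanSpace ℝ ι)

/-- The square integrable functions on a Gaussian space. -/
def sqInt (ι : Type*) [Fintype ι] : Submodule ℂ (EuclideanSpace ℝ ι → ℂ) where
  carrier := {h | MemLp h 2 (stdGaussian (EuclideanSpace ℝ ι))}
  add_mem' := fun h h' => MemLp.add h h'
  zero_mem' := MemLp.zero
  smul_mem' := fun c _ h => MemLp.const_smul h c

/-- The sum is `tr(x W)`, so it remains to bound the operator norm of `W`. Against unit vectors `u,
v` it becomes `∑_c r(f_c, g_c)`, where the `f_c` are the conjugated coordinates of `A^* u` and the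
`g_c` the coordinates of `A' v`. Hence `∑_c ‖f_c‖²` and `∑_c ‖g_c‖²` are at most `κ²`, whatever `d`
is. -/
lemma norm_sum_trace_bilinear_le {d : ℕ} {r : sqInt ι →ₗ[ℂ] sqInt ι →ₗ[ℂ] ℂ} {δ κ : ℝ}
    (hδ : 0 ≤ δ)
    (hr : ∀ f g : sqInt ι, ‖r f g‖ ≤ δ * (∫ x, ‖f.1 x‖ ^ 2 ∂γ + ∫ x, ‖g.1 x‖ ^ 2 ∂γ))
    (x : Matrix (Fin d) (Fin d) ℂ) {A A' : EuclideanSpace ℝ ι → Matrix (Fin d) (Fin d) ℂ}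
    (hA : ∀ X, opNorm (A X) ≤ κ) (hA' : ∀ X, opNorm (A' X) ≤ κ)
    (h h' : Fin d → Fin d → sqInt ι)
    (hh : ∀ a c X, (h a c).1 X = A X a c) (hh' : ∀ a c X, (h' a c).1 X = A' X a c) :
    ‖∑ a, ∑ b, ∑ c, x b a * r (h a c) (h' c b)‖ ≤ traceNorm x * (δ * (2 * κ ^ 2)) := by
  let W : Matrix (Fin d) (Fin d) ℂ := Matrix.of fun a b => ∑ c, r (h a c) (h' c b)
  have hW : ∑ a, ∑ b, ∑ c, x b a * r (h a c) (h' c b) = (x * W).trace := by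
    rw [Finset.sum_comm]
    simp [Matrix.trace, Matrix.mul_apply, W, Finset.mul_sum]
  rw [hW]
  refine (norm_trace_mul_le x W).trans (mul_le_mul_of_nonneg_left ?_ (traceNorm_nonneg x))
  refine opNorm_le_of_forall (by positivity) fun u v hu hv => ?_
  let f : Fin d → sqInt ι := fun c => ∑ a, star (u a) • h a c
  let g : Fin d → sqInt ι := fun c => ∑ b, v b • h' c b
  have hfg : star u.ofLp ⬝ᵥ W *ᵥ v.ofLp = ∑ c, r (f c) (g c) := by
    simp only [dotProduct, Matrix.mulVec, W, Matrix.of_apply, f, g, map_sum, map_smul,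
      LinearMap.sum_apply, LinearMap.smul_apply, smul_eq_mul, Finset.mul_sum, Finset.sum_mul,
      Pi.star_apply]
    rw [Finset.sum_comm]
    conv_rhs => rw [Finset.sum_comm]
    refine Finset.sum_congr rfl fun b _ => ?_
    rw [Finset.sum_comm]
    exact Finset.sum_congr rfl fun c _ => Finset.sum_congr rfl fun a _ => by ring
  have hu2 : ∑ i, ‖u i‖ ^ 2 = 1 := by rw [← EuclideanSpace.norm_sq_eq, hu, one_pow]
  have hv2 : ∑ i, ‖v i‖ ^ 2 = 1 := by rw [← EuclideanSpace.norm_sq_eq, hv, one_pow]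
  have hf : ∀ c X, (f c).1 X = star (((A X)ᴴ *ᵥ u.ofLp) c) := fun c X => by
    simp [f, Matrix.mulVec, dotProduct, hh, mul_comm]
  have hg : ∀ c X, (g c).1 X = (A' X *ᵥ v.ofLp) c := fun c X => by
    simp [g, Matrix.mulVec, dotProduct, hh', mul_comm]
  have hint : ∀ f : sqInt ι, Integrable (fun X => ‖f.1 X‖ ^ 2) γ := fun f => by
    have : MemLp f.1 2 γ := f.2
    exact this.integrable_norm_pow (by norm_num)
  have hfs : ∑ c, ∫ X, ‖(f c).1 X‖ ^ 2 ∂γ ≤ κ ^ 2 := by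
    rw [← integral_finsetSum _ fun c _ => hint _]
    have : ∀ X, ∑ c, ‖(f c).1 X‖ ^ 2 ≤ κ ^ 2 := fun X => by
      simp only [hf, norm_star]
      refine (sum_norm_sq_mulVec_le _ _).trans ?_
      rw [hu2, mul_one, opNorm_conjTranspose]
      exact pow_le_pow_left₀ (opNorm_nonneg _) (hA X) 2
    refine (integral_mono (integrable_finsetSum _ fun c _ => hint _) (integrable_const _)
      this).trans_eq ?_
    simp
  have hgs : ∑ c, ∫ X, ‖(g c).1 X‖ ^ 2 ∂γ ≤ κ ^ 2 := by
    rw [← integral_finsetSum _ fun c _ => hint _]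
    have : ∀ X, ∑ c, ‖(g c).1 X‖ ^ 2 ≤ κ ^ 2 := fun X => by
      simp only [hg]
      refine (sum_norm_sq_mulVec_le _ _).trans ?_
      rw [hv2, mul_one]
      exact pow_le_pow_left₀ (opNorm_nonneg _) (hA' X) 2
    refine (integral_mono (integrable_finsetSum _ fun c _ => hint _) (integrable_const _)
      this).trans_eq ?_
    simp
  rw [hfg]
  refine (norm_sum_le _ _).trans ((Finset.sum_le_sum fun c _ => hr (f c) (g c)).trans ?_)
  rw [← Finset.mul_sum, Finset.sum_add_distrib]
  refine mul_le_mul_of_nonneg_left ?_ hδ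
  linarith

end SquareIntegrable

/-! ### The trace form in real coordinates. -/

section GaussianForm

open scoped Matrix

variable {d : ℕ → ℕ} {N : ℕ}

local notation "𝔼" => EuclideanSpace ℝ (CoordIndex d N)

/-- The form `∑ n, d_n tr (g_n p_n^* g'_n q_n^*)` on complex coordinates. -/
def traceForm (p q : ∀ n : Fin N, Matrix (Fin (d n)) (Fin (d n)) ℂ)
    (G G' : ∀ n : Fin N, Matrix (Fin (d n)) (Fin (d n)) ℂ) : ℂ :=
  ∑ n : Fin N, (d n : ℂ) * (G n * (p n)ᴴ * G' n * (q n)ᴴ).trace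

/-- The matrices with complex coordinates `ζ`. -/
def coordMat (ζ : CoordIndex d N → ℂ) (n : Fin N) : Matrix (Fin (d n)) (Fin (d n)) ℂ :=
  ∑ k, ζ k • gMat (EuclideanSpace.single k (1 : ℝ)) n

lemma gMat_eq_coordMat (u : 𝔼) : gMat u = coordMat (d := d) (N := N) fun k => (u k : ℂ) := by
  funext n
  ext i j
  simp only [coordMat, Matrix.sum_apply, Matrix.smul_apply, gMat, Matrix.of_apply, smul_eq_mul,
    PiLp.single_apply]
  simp only [mul_add, Finset.sum_add_distrib, mul_left_comm _ (((√(2 * d n))⁻¹ : ℝ) : ℂ),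
    ← Finset.mul_sum]
  congr 1
  · simp [apply_ite Complex.ofReal]
  · simp [apply_ite Complex.ofReal, mul_comm]

lemma traceForm_coordMat (p q : ∀ n : Fin N, Matrix (Fin (d n)) (Fin (d n)) ℂ)
    (ζ ω : CoordIndex d N → ℂ) :
    traceForm p q (coordMat ζ) (coordMat ω) = ∑ k, ∑ l,
      traceForm p q (gMat (EuclideanSpace.single k (1 : ℝ))) (gMat (EuclideanSpace.single l (1 : ℝ)))
        * (ζ k * ω l) := by
  simp only [traceForm, coordMat, Matrix.smul_mul, Matrix.mul_smul,
    Matrix.trace_sum, Matrix.trace_smul, smul_eq_mul, Finset.mul_sum, Finset.sum_mul]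
  rw [Finset.sum_comm]
  conv_rhs => rw [Finset.sum_comm]
  refine Finset.sum_congr rfl fun l _ => ?_
  rw [Finset.sum_comm]
  exact Finset.sum_congr rfl fun k _ => Finset.sum_congr rfl fun n _ => by ring

lemma sum_frobSq_gMat_le (u : 𝔼) : ∑ n : Fin N, (d n : ℝ) * frobSq (gMat u n) ≤ ‖u‖ ^ 2 := by
  rw [EuclideanSpace.real_norm_sq_eq, Fintype.sum_sigma]
  refine Finset.sum_le_sum fun n _ => ?_
  rw [Fintype.sum_prod_type, Fintype.sum_prod_type, frobSq, Finset.mul_sum]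
  refine Finset.sum_le_sum fun i _ => ?_
  rw [Finset.mul_sum]
  refine Finset.sum_le_sum fun j _ => ?_
  have hd : 0 < (d n : ℝ) := by exact_mod_cast i.pos
  rw [Fintype.sum_bool, gMat, Matrix.of_apply, norm_mul, mul_pow, mul_comm Complex.I,
    Complex.norm_add_mul_I, Real.sq_sqrt (by positivity), Complex.norm_real, norm_inv, inv_pow,
    Real.norm_eq_abs, sq_abs, Real.sq_sqrt (by positivity), mul_inv, ← mul_assoc, mul_comm 2⁻¹,
    ← mul_assoc, mul_inv_cancel₀ hd.ne', one_mul]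
  nlinarith [sq_nonneg (u ⟨n, (i, j), true⟩), sq_nonneg (u ⟨n, (i, j), false⟩)]

/-- Cauchy–Schwarz for the Hilbert–Schmidt norm in each block and then over `n`. The weights `d_n`
match the normalisation of the coordinates. -/
lemma norm_traceForm_gMat_le {p q : ∀ n : Fin N, Matrix (Fin (d n)) (Fin (d n)) ℂ} {κ : ℝ}
    (hp : ∀ n, opNorm (p n) ≤ κ) (hq : ∀ n, opNorm (q n) ≤ κ) (u v : 𝔼) :
    ‖traceForm p q (gMat u) (gMat v)‖ ≤ κ ^ 2 * (‖u‖ * ‖v‖) := by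
  have h1 : ∀ n : Fin N, ‖(d n : ℂ) * (gMat u n * (p n)ᴴ * gMat v n * (q n)ᴴ).trace‖ ≤
      κ ^ 2 * (√(d n * frobSq (gMat u n)) * √(d n * frobSq (gMat v n))) := fun n => by
    have h2 := norm_trace_mul_le_frobSq (gMat u n) ((p n)ᴴ * gMat v n * (q n)ᴴ)
    have h3 : √(frobSq ((p n)ᴴ * gMat v n * (q n)ᴴ)) ≤ κ ^ 2 * √(frobSq (gMat v n)) := by
      rw [Real.sqrt_le_left (by positivity), mul_pow, Real.sq_sqrt (frobSq_nonneg _)]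
      refine (frobSq_mul_mul_le _ _ _).trans ?_
      refine mul_le_mul_of_nonneg_right ?_ (frobSq_nonneg _)
      rw [opNorm_conjTranspose, opNorm_conjTranspose]
      calc _ ≤ κ ^ 2 * κ ^ 2 := by
            gcongr <;> first | exact opNorm_nonneg _ | exact hp n | exact hq n
        _ = _ := by ring
    rw [norm_mul, Complex.norm_natCast, mul_assoc, mul_assoc, ← mul_assoc ((p n)ᴴ),
      Real.sqrt_mul (Nat.cast_nonneg _), Real.sqrt_mul (Nat.cast_nonneg _)]
    calc _ ≤ (d n : ℝ) * (√(frobSq (gMat u n)) * (κ ^ 2 * √(frobSq (gMat v n)))) := by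
          gcongr; exact h2.trans (by gcongr)
      _ = (√(d n) * √(d n)) * (√(frobSq (gMat u n)) * (κ ^ 2 * √(frobSq (gMat v n)))) := by
          rw [Real.mul_self_sqrt (Nat.cast_nonneg _)]
      _ = _ := by ring
  refine (norm_sum_le _ _).trans ((Finset.sum_le_sum fun n _ => h1 n).trans ?_)
  rw [← Finset.mul_sum]
  refine mul_le_mul_of_nonneg_left ?_ (by positivity)
  refine (Real.sum_mul_le_sqrt_mul_sqrt _ _ _).trans ?_
  have h4 : ∀ w : 𝔼, √(∑ n : Fin N, √(d n * frobSq (gMat w n)) ^ 2) ≤ ‖w‖ := fun w => by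
    rw [Real.sqrt_le_left (norm_nonneg _)]
    refine le_of_eq_of_le (Finset.sum_congr rfl fun n _ => ?_) (sum_frobSq_gMat_le w)
    exact Real.sq_sqrt (mul_nonneg (Nat.cast_nonneg _) (frobSq_nonneg _))
  exact mul_le_mul (h4 u) (h4 v) (Real.sqrt_nonneg _) (norm_nonneg _)

end GaussianForm

/-! ### Bilinear forms given by integration against couplings. -/

section BilinearCouplings

open scoped Matrix

variable {ι : Type*} [Fintype ι]

local notation "γ" => stdGaussian (EuclideanSpace ℝ ι)

/-- A bilinear form on square integrable functions which, on finite sums of products, is bounded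
by `K` times the supremum norm of the corresponding function of two variables. -/
def IsSupBounded (D : sqInt ι →ₗ[ℂ] sqInt ι →ₗ[ℂ] ℂ) (K : ℝ) : Prop :=
  ∀ (κ : Type) (s : Finset κ) (c : κ → ℂ) (h h' : κ → sqInt ι) (M : ℝ),
    (∀ x y, ‖∑ k ∈ s, c k * ((h k).1 x * (h' k).1 y)‖ ≤ M) →
      ‖∑ k ∈ s, c k * D (h k) (h' k)‖ ≤ K * M

lemma IsSupBounded.add {D D' : sqInt ι →ₗ[ℂ] sqInt ι →ₗ[ℂ] ℂ} {K K' : ℝ}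
    (hD : IsSupBounded D K) (hD' : IsSupBounded D' K') : IsSupBounded (D + D') (K + K') := by
  intro κ s c h h' M hM
  simp only [LinearMap.add_apply, mul_add, Finset.sum_add_distrib]
  rw [add_mul]
  exact (norm_add_le _ _).trans (add_le_add (hD κ s c h h' M hM) (hD' κ s c h h' M hM))

lemma IsSupBounded.smul {D : sqInt ι →ₗ[ℂ] sqInt ι →ₗ[ℂ] ℂ} {K : ℝ}
    (hD : IsSupBounded D K) (a : ℂ) : IsSupBounded (a • D) (‖a‖ * K) := by
  intro κ s c h h' M hM
  simp only [LinearMap.smul_apply, smul_eq_mul, mul_left_comm _ a, ← Finset.mul_sum]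
  rw [norm_mul, mul_assoc]
  exact mul_le_mul_of_nonneg_left (hD κ s c h h' M hM) (norm_nonneg _)

lemma exists_bilinear_integral {π : Measure (EuclideanSpace ℝ ι × EuclideanSpace ℝ ι)}
    [IsProbabilityMeasure π]
    (hπ : ∀ h h' : sqInt ι, Integrable (fun z => h.1 z.1 * h'.1 z.2) π) :
    ∃ D : sqInt ι →ₗ[ℂ] sqInt ι →ₗ[ℂ] ℂ, IsSupBounded D 1 ∧
      ∀ h h', D h h' = ∫ z, h.1 z.1 * h'.1 z.2 ∂π := by
  let D : sqInt ι →ₗ[ℂ] sqInt ι →ₗ[ℂ] ℂ := LinearMap.mk₂ ℂ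
    (fun h h' => ∫ z, h.1 z.1 * h'.1 z.2 ∂π)
    (fun f g h => by
      rw [← integral_add (hπ f h) (hπ g h)]
      exact integral_congr_ae (.of_forall fun z => add_mul _ _ _))
    (fun a f h => by
      rw [smul_eq_mul, ← integral_const_mul]
      exact integral_congr_ae (.of_forall fun z => mul_assoc _ _ _))
    (fun f g h => by
      rw [← integral_add (hπ f g) (hπ f h)]
      exact integral_congr_ae (.of_forall fun z => mul_add _ _ _))
    (fun a f h => by
      rw [smul_eq_mul, ← integral_const_mul]
      exact integral_congr_ae (.of_forall fun z => mul_left_comm _ _ _))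
  refine ⟨D, fun κ s c h h' M hM => ?_, fun h h' => rfl⟩
  have : ∑ k ∈ s, c k * D (h k) (h' k) =
      ∫ z, ∑ k ∈ s, c k * ((h k).1 z.1 * (h' k).1 z.2) ∂π := by
    rw [integral_finsetSum _ fun k _ => (hπ _ _).const_mul _]
    exact Finset.sum_congr rfl fun k _ => (integral_const_mul _ _).symm
  rw [this, one_mul]
  simpa using norm_integral_le_of_norm_le_const (μ := π) (.of_forall fun z => hM z.1 z.2)

lemma exists_bilinear_approx_real {α : Matrix ι ι ℝ} (hα : IsBilinContraction α) {ε : ℝ}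
    (h0 : 0 ≤ ε) (h1 : ε ≤ 1) :
    ∃ D : sqInt ι →ₗ[ℂ] sqInt ι →ₗ[ℂ] ℂ, IsSupBounded D 1 ∧ ∀ h h' : sqInt ι,
      ‖D h h' - ε * ∑ p, ∑ q, α p q * ((∫ x, (x p : ℂ) * h.1 x ∂γ) * ∫ x, (x q : ℂ) * h'.1 x ∂γ)‖ ≤
          ε ^ 3 * (∫ x, ‖h.1 x‖ ^ 2 ∂γ + ∫ x, ‖h'.1 x‖ ^ 2 ∂γ) / 2 := by
  obtain ⟨π₁, π₂, i₁, i₂, hπ⟩ := exists_couplings_approx hα h0 h1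
  obtain ⟨D₁, hD₁, e₁⟩ := exists_bilinear_integral (π := π₁) fun h h' => (hπ _ _ h.2 h'.2).1
  obtain ⟨D₂, hD₂, e₂⟩ := exists_bilinear_integral (π := π₂) fun h h' => (hπ _ _ h.2 h'.2).2.1
  -- The constant `1` is `1/2 + 1/2`.
  refine ⟨(1 / 2 : ℂ) • D₁ + (-(1 / 2) : ℂ) • D₂, ?_, fun h h' => ?_⟩
  · have := (hD₁.smul (1 / 2 : ℂ)).add (hD₂.smul (-(1 / 2) : ℂ))
    norm_num at this ⊢
    exact this
  · refine le_of_eq_of_le ?_ (hπ _ _ h.2 h'.2).2.2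
    rw [LinearMap.add_apply, LinearMap.add_apply, LinearMap.smul_apply, LinearMap.smul_apply,
      LinearMap.smul_apply, LinearMap.smul_apply, e₁, e₂, smul_eq_mul, smul_eq_mul]
    congr 2
    ring

end BilinearCouplings

/-! ### The main estimate for the averaged trace form. -/

section GaussianEstimate

open scoped Matrix

variable {d : ℕ → ℕ} {N : ℕ}

local notation "𝔼" => EuclideanSpace ℝ (CoordIndex d N)
local notation "γ" => stdGaussian (EuclideanSpace ℝ (CoordIndex d N))

/-- The matrices `𝔼 (h g_n)`. -/
def meanMat (h : sqInt (CoordIndex d N)) (n : Fin N) : Matrix (Fin (d n)) (Fin (d n)) ℂ :=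
  Matrix.of fun i j => ∫ X, gMat X n i j * h.1 X ∂γ

lemma integrable_mul_sqInt {f : 𝔼 → ℂ} (hf : MemLp f 2 γ) (h : sqInt (CoordIndex d N)) :
    Integrable (fun X => f X * h.1 X) γ :=
  MemLp.integrable_mul hf h.2

lemma meanMat_eq_coordMat (h : sqInt (CoordIndex d N)) :
    meanMat h = coordMat fun k => ∫ X, (X k : ℂ) * h.1 X ∂γ := by
  funext n
  ext i j
  have : ∀ X : 𝔼, gMat X n i j * h.1 X =
      ∑ k, (X k : ℂ) * h.1 X * gMat (EuclideanSpace.single k (1 : ℝ)) n i j := fun X => by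
    rw [gMat_eq_coordMat]
    simp only [coordMat, Matrix.sum_apply, Matrix.smul_apply, smul_eq_mul, Finset.sum_mul]
    exact Finset.sum_congr rfl fun k _ => by ring
  simp only [meanMat, Matrix.of_apply, this, coordMat, Matrix.sum_apply, Matrix.smul_apply,
    smul_eq_mul]
  rw [integral_finsetSum _ fun k _ => (integrable_mul_sqInt (memLp_coord k) h).mul_const _]
  exact Finset.sum_congr rfl fun k _ => integral_mul_const _ _

/-- The bilinear form `∑ n, d_n tr (𝔼 (h g_n) p_n^* 𝔼 (h' g_n) q_n^*)`. -/
def meanForm (p q : ∀ n : Fin N, Matrix (Fin (d n)) (Fin (d n)) ℂ) :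
    sqInt (CoordIndex d N) →ₗ[ℂ] sqInt (CoordIndex d N) →ₗ[ℂ] ℂ :=
  have hadd : ∀ f g : sqInt (CoordIndex d N), meanMat (f + g) = meanMat f + meanMat g := by
    intro f g
    funext n; ext i j
    simp only [meanMat, Pi.add_apply, Matrix.add_apply, Matrix.of_apply]
    rw [← integral_add (integrable_mul_sqInt (memLp_gMat n i j) f)
      (integrable_mul_sqInt (memLp_gMat n i j) g)]
    exact integral_congr_ae (.of_forall fun X => mul_add _ _ _)
  have hsmul : ∀ (a : ℂ) (f : sqInt (CoordIndex d N)), meanMat (a • f) = a • meanMat f := by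
    intro a f
    funext n; ext i j
    simp only [meanMat, Pi.smul_apply, Matrix.smul_apply, Matrix.of_apply, smul_eq_mul]
    rw [← integral_const_mul]
    exact integral_congr_ae (.of_forall fun X => mul_left_comm _ _ _)
  LinearMap.mk₂ ℂ (fun h h' => traceForm p q (meanMat h) (meanMat h'))
    (fun f g h => by
      simp only [hadd, traceForm, Pi.add_apply, Matrix.add_mul, Matrix.trace_add, mul_add,
        Finset.sum_add_distrib])
    (fun a f h => by
      simp only [hsmul, traceForm, Pi.smul_apply, Matrix.smul_mul, Matrix.trace_smul, smul_eq_mul,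
        Finset.mul_sum, mul_left_comm a])
    (fun f g h => by
      simp only [hadd, traceForm, Pi.add_apply, Matrix.add_mul, Matrix.trace_add, mul_add,
        Finset.sum_add_distrib])
    (fun a f h => by
      simp only [hsmul, traceForm, Pi.smul_apply, Matrix.smul_mul, Matrix.mul_smul,
        Matrix.trace_smul, smul_eq_mul, Finset.mul_sum, mul_left_comm a])

lemma meanForm_apply (p q : ∀ n : Fin N, Matrix (Fin (d n)) (Fin (d n)) ℂ)
    (h h' : sqInt (CoordIndex d N)) :
    meanForm p q h h' = traceForm p q (meanMat h) (meanMat h') := rfl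

/-- The real and imaginary parts of the coefficient matrix, divided by `κ²`, are real contractions.
Each is approximated separately, whence the constant `2κ² = κ²(1 + 1)`. -/
lemma exists_bilinear_approx {p q : ∀ n : Fin N, Matrix (Fin (d n)) (Fin (d n)) ℂ} {κ : ℝ}
    (hκ : 0 < κ) (hp : ∀ n, opNorm (p n) ≤ κ) (hq : ∀ n, opNorm (q n) ≤ κ) {ε : ℝ}
    (h0 : 0 ≤ ε) (h1 : ε ≤ 1) :
    ∃ D : sqInt (CoordIndex d N) →ₗ[ℂ] sqInt (CoordIndex d N) →ₗ[ℂ] ℂ,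
      IsSupBounded D (2 * κ ^ 2) ∧ ∀ h h',
      ‖D h h' - ε * meanForm p q h h'‖ ≤
          κ ^ 2 * ε ^ 3 * (∫ x, ‖h.1 x‖ ^ 2 ∂γ + ∫ x, ‖h'.1 x‖ ^ 2 ∂γ) := by
  let B : Matrix (CoordIndex d N) (CoordIndex d N) ℂ := Matrix.of fun k l =>
    traceForm p q (gMat (EuclideanSpace.single k (1 : ℝ))) (gMat (EuclideanSpace.single l (1 : ℝ)))
  have hB : ∀ u v : 𝔼, ∑ k, ∑ l, B k l * ((u k : ℂ) * (v l : ℂ)) =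
      traceForm p q (gMat u) (gMat v) := fun u v => by
    rw [gMat_eq_coordMat u, gMat_eq_coordMat v, traceForm_coordMat]; rfl
  have hκ2 : (κ ^ 2 : ℝ) ≠ 0 := by positivity
  have key : ∀ L : ℂ →ₗ[ℝ] ℝ, (∀ z, |L z| ≤ ‖z‖) →
      IsBilinContraction (Matrix.of fun k l => (κ ^ 2)⁻¹ * L (B k l)) := by
    intro L hL u v
    have : u.ofLp ⬝ᵥ (Matrix.of fun k l => (κ ^ 2)⁻¹ * L (B k l)) *ᵥ v.ofLp =
        (κ ^ 2)⁻¹ * L (traceForm p q (gMat u) (gMat v)) := by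
      rw [← hB]
      have e : ∀ k l, B k l * ((u k : ℂ) * (v l : ℂ)) = (u k * v l) • B k l := fun k l => by
        rw [Complex.real_smul]; push_cast; ring
      simp only [e, map_sum, map_smul, dotProduct, Matrix.mulVec, Matrix.of_apply, Finset.mul_sum,
        smul_eq_mul]
      exact Finset.sum_congr rfl fun k _ => Finset.sum_congr rfl fun l _ => by ring
    rw [this, abs_mul, abs_inv, abs_of_nonneg (by positivity : 0 ≤ κ ^ 2),
      inv_mul_le_iff₀ (by positivity)]
    exact (hL _).trans (norm_traceForm_gMat_le hp hq u v)
  obtain ⟨D₁, hD₁, e₁⟩ := exists_bilinear_approx_real (key Complex.reLm Complex.abs_re_le_norm) h0 h1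
  obtain ⟨D₂, hD₂, e₂⟩ := exists_bilinear_approx_real (key Complex.imLm Complex.abs_im_le_norm) h0 h1
  refine ⟨((κ ^ 2 : ℝ) : ℂ) • (D₁ + Complex.I • D₂), ?_, fun h h' => ?_⟩
  · have := (hD₁.add (hD₂.smul Complex.I)).smul ((κ ^ 2 : ℝ) : ℂ)
    rw [Complex.norm_real, Complex.norm_I, Real.norm_of_nonneg (by positivity)] at this
    convert this using 1
    ring
  · set P := fun k => ∫ x, (x k : ℂ) * h.1 x ∂γ
    set Q := fun k => ∫ x, (x k : ℂ) * h'.1 x ∂γ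
    have hm : meanForm p q h h' = ((κ ^ 2 : ℝ) : ℂ) *
        (∑ k, ∑ l, (((κ ^ 2)⁻¹ * (B k l).re : ℝ) : ℂ) * (P k * Q l) +
          Complex.I * ∑ k, ∑ l, (((κ ^ 2)⁻¹ * (B k l).im : ℝ) : ℂ) * (P k * Q l)) := by
      rw [meanForm_apply, meanMat_eq_coordMat, meanMat_eq_coordMat, traceForm_coordMat]
      simp only [Finset.mul_sum, ← Finset.sum_add_distrib]
      refine Finset.sum_congr rfl fun k _ => Finset.sum_congr rfl fun l _ => ?_
      have hBkl : traceForm p q (gMat (EuclideanSpace.single k (1 : ℝ)))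
          (gMat (EuclideanSpace.single l (1 : ℝ))) = ((B k l).re : ℂ) + (B k l).im * Complex.I :=
        (Complex.re_add_im _).symm
      have hc : ((κ ^ 2 : ℝ) : ℂ) ≠ 0 := by exact_mod_cast hκ2
      rw [hBkl, Complex.ofReal_mul, Complex.ofReal_mul, Complex.ofReal_inv]
      field_simp
      rfl
    have e₁' := e₁ h h'
    have e₂' := e₂ h h'
    simp only [Matrix.of_apply, Complex.reLm_coe, Complex.imLm_coe] at e₁' e₂'
    set S₁ := ∑ k, ∑ l, (((κ ^ 2)⁻¹ * (B k l).re : ℝ) : ℂ) * (P k * Q l)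
    set S₂ := ∑ k, ∑ l, (((κ ^ 2)⁻¹ * (B k l).im : ℝ) : ℂ) * (P k * Q l)
    have : (((κ ^ 2 : ℝ) : ℂ) • (D₁ + Complex.I • D₂)) h h' - ε * meanForm p q h h' =
        ((κ ^ 2 : ℝ) : ℂ) * ((D₁ h h' - ε * S₁) + Complex.I * (D₂ h h' - ε * S₂)) := by
      rw [hm]
      simp only [LinearMap.smul_apply, LinearMap.add_apply, smul_eq_mul]
      ring
    rw [this, norm_mul, Complex.norm_real, Real.norm_of_nonneg (by positivity), mul_assoc]
    refine mul_le_mul_of_nonneg_left ?_ (by positivity)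
    refine (norm_add_le _ _).trans ?_
    rw [norm_mul, Complex.norm_I, one_mul]
    linarith

/-- The main Gaussian estimate. -/
theorem norm_sum_meanForm_le {p q : ∀ n : Fin N, Matrix (Fin (d n)) (Fin (d n)) ℂ} {κ τ : ℝ}
    (hκ : 0 < κ) (hp : ∀ n, opNorm (p n) ≤ κ) (hq : ∀ n, opNorm (q n) ≤ κ) {ε : ℝ}
    (h0 : 0 < ε) (h1 : ε ≤ 1) (x : ∀ n : Fin N, Matrix (Fin (d n)) (Fin (d n)) ℂ)
    {A A' : 𝔼 → ∀ n : Fin N, Matrix (Fin (d n)) (Fin (d n)) ℂ}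
    (hA : ∀ X n, opNorm (A X n) ≤ τ) (hA' : ∀ X n, opNorm (A' X n) ≤ τ)
    {h h' : ∀ n : Fin N, Fin (d n) → Fin (d n) → sqInt (CoordIndex d N)}
    (hh : ∀ n a c X, (h n a c).1 X = A X n a c) (hh' : ∀ n a c X, (h' n a c).1 X = A' X n a c)
    {M : ℝ} (hM : ∀ X Y, ‖∑ n : Fin N, (d n : ℂ) * (x n * A X n * A' Y n).trace‖ ≤ M) :
    ‖∑ n : Fin N, (d n : ℂ) * ∑ a, ∑ b, ∑ c, x n b a * meanForm p q (h n a c) (h' n c b)‖ ≤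
      2 * κ ^ 2 / ε * M + 2 * κ ^ 2 * τ ^ 2 * ε ^ 2 * ∑ n : Fin N, (d n : ℝ) * traceNorm (x n) := by
  obtain ⟨D, hD, hDm⟩ := exists_bilinear_approx hκ hp hq h0.le h1
  have hD1 : ‖∑ n : Fin N, (d n : ℂ) * ∑ a, ∑ b, ∑ c, x n b a * D (h n a c) (h' n c b)‖ ≤
      2 * κ ^ 2 * M := by
    have := hD (Σ n : Fin N, Fin (d n) × Fin (d n) × Fin (d n)) Finset.univ
      (fun k => (d k.1 : ℂ) * x k.1 k.2.2.1 k.2.1) (fun k => h k.1 k.2.1 k.2.2.2)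
      (fun k => h' k.1 k.2.2.2 k.2.2.1) M (fun X Y => ?_)
    · refine le_of_eq_of_le ?_ this
      simp only [Fintype.sum_sigma, Fintype.sum_prod_type, Finset.mul_sum, mul_assoc]
    · refine le_of_eq_of_le ?_ (hM X Y)
      congr 1
      simp only [Fintype.sum_sigma, Fintype.sum_prod_type, mul_assoc, hh, hh', ← Finset.mul_sum]
      refine Finset.sum_congr rfl fun n _ => ?_
      congr 1
      rw [Finset.sum_comm]
      simp only [Matrix.trace, Matrix.diag_apply, Matrix.mul_apply]
  have hR : ∀ n : Fin N, ‖∑ a, ∑ b, ∑ c, x n b a *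
      (D - (ε : ℂ) • meanForm p q) (h n a c) (h' n c b)‖ ≤
      traceNorm (x n) * (κ ^ 2 * ε ^ 3 * (2 * τ ^ 2)) := fun n => by
    refine norm_sum_trace_bilinear_le (by positivity) (fun f g => ?_) (x n)
      (fun X => hA X n) (fun X => hA' X n) (h n) (h' n) (hh n) (hh' n)
    exact hDm f g
  -- Split `ε B = D - (D - ε B)`: the first term is controlled by the supremum norm, the second by
  -- the trace norms. Division by `ε` then leaves `1/ε` and `ε²`.
  have hsplit : (ε : ℂ) * ∑ n : Fin N, (d n : ℂ) * ∑ a, ∑ b, ∑ c,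
      x n b a * meanForm p q (h n a c) (h' n c b) =
      ∑ n : Fin N, (d n : ℂ) * ∑ a, ∑ b, ∑ c, x n b a * D (h n a c) (h' n c b) -
      ∑ n : Fin N, (d n : ℂ) * ∑ a, ∑ b, ∑ c, x n b a *
        (D - (ε : ℂ) • meanForm p q) (h n a c) (h' n c b) := by
    simp only [Finset.mul_sum, ← Finset.sum_sub_distrib]
    refine Finset.sum_congr rfl fun n _ => Finset.sum_congr rfl fun a _ =>
      Finset.sum_congr rfl fun b _ => Finset.sum_congr rfl fun c _ => ?_
    simp only [LinearMap.sub_apply, LinearMap.smul_apply, smul_eq_mul]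
    ring
  have hfin : ε * ‖∑ n : Fin N, (d n : ℂ) * ∑ a, ∑ b, ∑ c,
      x n b a * meanForm p q (h n a c) (h' n c b)‖ ≤ 2 * κ ^ 2 * M +
      ∑ n : Fin N, (d n : ℝ) * (traceNorm (x n) * (κ ^ 2 * ε ^ 3 * (2 * τ ^ 2))) := by
    rw [← Real.norm_of_nonneg h0.le, ← Complex.norm_real, ← norm_mul, hsplit]
    refine (norm_sub_le _ _).trans (add_le_add hD1 ((norm_sum_le _ _).trans
      (Finset.sum_le_sum fun n _ => ?_)))
    rw [norm_mul, Complex.norm_natCast, Complex.norm_real, Real.norm_of_nonneg h0.le]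
    exact mul_le_mul_of_nonneg_left (hR n) (Nat.cast_nonneg _)
  rw [← le_div_iff₀' h0] at hfin
  refine hfin.trans_eq ?_
  simp only [← mul_assoc, ← Finset.sum_mul]
  field_simp

end GaussianEstimate

/-! ### Slices of null sets in product spaces. -/

section ProductSlices

variable {T : Type*} [MeasurableSpace T] {m : Measure T} [IsProbabilityMeasure m]

lemma ae_pi_insertNth {n : ℕ} {p : (Fin (n + 1) → T) → Prop}
    (h : ∀ᵐ t ∂(Measure.pi fun _ : Fin (n + 1) => m), p t) (i : Fin (n + 1)) :
    ∀ᵐ a ∂m, ∀ᵐ t ∂(Measure.pi fun _ : Fin n => m), p (i.insertNth a t) := by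
  have h1 := (measurePreserving_piFinSuccAbove (fun _ : Fin (n + 1) => m) i).symm
  exact Measure.ae_ae_of_ae_prod (h1.quasiMeasurePreserving.ae h)

/-- Positions `0` and `2` come outermost because `s` and `s'` stay fixed while functionals act on
`t` and `t'`. -/
lemma ae_pi_four {p : (Fin 4 → T) → Prop} (h : ∀ᵐ t ∂(Measure.pi fun _ : Fin 4 => m), p t) :
    ∀ᵐ s ∂m, ∀ᵐ s' ∂m, ∀ᵐ t ∂m, ∀ᵐ t' ∂m, p ![s, t, s', t'] := by
  filter_upwards [ae_pi_insertNth h 0] with s hs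
  -- Once position `0` is removed, index `1` is position `2` of the four.
  filter_upwards [ae_pi_insertNth hs 1] with s' hs'
  filter_upwards [ae_pi_insertNth hs' 0] with t ht
  filter_upwards [ae_pi_insertNth ht 0] with t' ht'
  obtain ⟨z, hz⟩ := ht'.exists
  convert hz using 1
  ext j
  fin_cases j <;> rfl

end ProductSlices

/-! ### Matrices obtained by applying a functional to the entries. -/

section DualMatrices

open scoped Matrix

variable {T : Type*} [MeasurableSpace T] {m : Measure T} [IsProbabilityMeasure m]
  {d : ℕ → ℕ} {ψ : ∀ n, T → Matrix (Fin (d n)) (Fin (d n)) ℂ}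
  {e : ∀ n, Fin (d n) → Fin (d n) → Lp ℂ ∞ m}

lemma norm_sum_trace_dualMat_le (he : ∀ n, ∀ᵐ t ∂m, ∀ i j, e n i j t = ψ n t i j)
    {ℓ : StrongDual ℂ (Lp ℂ ∞ m)} (hℓ : ‖ℓ‖ ≤ 1) {N : ℕ}
    (a : ∀ n : Fin N, Matrix (Fin (d n)) (Fin (d n)) ℂ) {M : ℝ} (hM : 0 ≤ M)
    (h : ∀ᵐ t ∂m, ‖∑ n : Fin N, (a n * ψ n t).trace‖ ≤ M) :
    ‖∑ n : Fin N, (a n * dualMat e ℓ n).trace‖ ≤ M := by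
  rw [← apply_entryComb]
  refine norm_apply_le_of_ae_bound hℓ hM ?_
  filter_upwards [coeFn_entryComb he a, h] with t h1 h2
  rwa [h1]

lemma norm_trace_dualMat_le (he : ∀ n, ∀ᵐ t ∂m, ∀ i j, e n i j t = ψ n t i j)
    {ℓ : StrongDual ℂ (Lp ℂ ∞ m)} (hℓ : ‖ℓ‖ ≤ 1) (n : ℕ)
    (a : Matrix (Fin (d n)) (Fin (d n)) ℂ) {M : ℝ} (hM : 0 ≤ M)
    (h : ∀ᵐ t ∂m, ‖(a * ψ n t).trace‖ ≤ M) :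
    ‖(a * dualMat e ℓ n).trace‖ ≤ M := by
  let a' : ∀ k : Fin (n + 1), Matrix (Fin (d k)) (Fin (d k)) ℂ := Function.update 0 (Fin.last n) a
  have key : ∀ b : ∀ k, Matrix (Fin (d k)) (Fin (d k)) ℂ,
      ∑ k : Fin (n + 1), (a' k * b k).trace = (a * b n).trace := fun b => by
    rw [Finset.sum_eq_single (Fin.last n)]
    · simp only [a', Function.update_self]; rfl
    · intro k _ hk
      simp only [a', Function.update_of_ne hk, Pi.zero_apply, Matrix.zero_mul, Matrix.trace_zero]
    · simp
  have := norm_sum_trace_dualMat_le he hℓ a' hM (by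
    filter_upwards [h] with t ht
    rwa [key fun k => ψ k t])
  rwa [key] at this

/-- Testing against rank-one matrices turns the matrix bound into bounds for scalar functions, to
which the functional applies. -/
lemma opNorm_dualMat_le (he : ∀ n, ∀ᵐ t ∂m, ∀ i j, e n i j t = ψ n t i j) {κ : ℝ} (hκ : 0 ≤ κ)
    {n : ℕ} (hψ : ∀ᵐ t ∂m, opNorm (ψ n t) ≤ κ)
    {ℓ : StrongDual ℂ (Lp ℂ ∞ m)} (hℓ : ‖ℓ‖ ≤ 1) : opNorm (dualMat e ℓ n) ≤ κ := by
  refine opNorm_le_of_forall hκ fun u v hu hv => ?_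
  have htr : ∀ b : Matrix (Fin (d n)) (Fin (d n)) ℂ,
      star u.ofLp ⬝ᵥ b *ᵥ v.ofLp = (Matrix.vecMulVec v.ofLp (star u.ofLp) * b).trace := fun b => by
    rw [Matrix.trace_mul_comm, Matrix.mul_vecMulVec, Matrix.trace_vecMulVec, dotProduct_comm]
  rw [htr]
  refine norm_trace_dualMat_le he hℓ n _ hκ ?_
  filter_upwards [hψ] with t ht
  rw [← htr]
  refine (norm_star_dotProduct_mulVec_le _ _ _).trans ?_
  rwa [hu, hv, mul_one, mul_one]

/-- Slices of an essentially bounded function are bounded under a pair of functionals. -/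
lemma norm_sum_trace_pair_le (he : ∀ n, ∀ᵐ t ∂m, ∀ i j, e n i j t = ψ n t i j) {N : ℕ}
    (x a b : ∀ n : Fin N, Matrix (Fin (d n)) (Fin (d n)) ℂ) {M : ℝ} (hM : 0 ≤ M)
    (h : ∀ᵐ t ∂m, ∀ᵐ t' ∂m,
      ‖∑ n : Fin N, (d n : ℂ) * (x n * (a n * ψ n t * b n * ψ n t')).trace‖ ≤ M)
    {ℓ ℓ' : StrongDual ℂ (Lp ℂ ∞ m)} (hℓ : ‖ℓ‖ ≤ 1) (hℓ' : ‖ℓ'‖ ≤ 1) :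
    ‖∑ n : Fin N, (d n : ℂ) * (x n * (a n * dualMat e ℓ n) * (b n * dualMat e ℓ' n)).trace‖ ≤ M := by
  have e1 : ∀ n : Fin N, (d n : ℂ) * (x n * (a n * dualMat e ℓ n) * (b n * dualMat e ℓ' n)).trace =
      (((d n : ℂ) • (b n * dualMat e ℓ' n * x n * a n)) * dualMat e ℓ n).trace := fun n => by
    rw [Matrix.smul_mul, Matrix.trace_smul, smul_eq_mul, Matrix.trace_mul_comm]
    simp only [mul_assoc]
  simp only [e1]
  refine norm_sum_trace_dualMat_le he hℓ _ hM ?_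
  filter_upwards [h] with t ht
  have e2 : ∀ n : Fin N, (((d n : ℂ) • (b n * dualMat e ℓ' n * x n * a n)) * ψ n t).trace =
      (((d n : ℂ) • (x n * a n * ψ n t * b n)) * dualMat e ℓ' n).trace := fun n => by
    rw [Matrix.smul_mul, Matrix.trace_smul, Matrix.smul_mul, Matrix.trace_smul,
      Matrix.trace_mul_comm (x n * a n * ψ n t * b n), mul_assoc (b n), mul_assoc (b n),
      mul_assoc (b n), Matrix.trace_mul_comm (b n)]
    simp only [mul_assoc]
  simp only [e2]
  refine norm_sum_trace_dualMat_le he hℓ' _ hM ?_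
  filter_upwards [ht] with t' ht'
  refine le_of_eq_of_le ?_ ht'
  simp only [Matrix.smul_mul, Matrix.trace_smul, smul_eq_mul, mul_assoc]

end DualMatrices

/-! ### Expansion of the form in the entries of `φ` and `ψ`. -/

section Biorthogonality

open scoped Matrix

variable {d : ℕ → ℕ} {N : ℕ}

local notation "𝔼" => EuclideanSpace ℝ (CoordIndex d N)
local notation "γ" => stdGaussian (EuclideanSpace ℝ (CoordIndex d N))

lemma trace_mul_four {n : ℕ} (A B C D : Matrix (Fin n) (Fin n) ℂ) :
    (A * B * C * D).trace = ∑ l, ∑ j, ∑ i, ∑ k, A l k * B k i * C i j * D j l := by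
  simp only [Matrix.trace, Matrix.diag_apply, Matrix.mul_apply, Finset.sum_mul]

/-- The moment `𝔼 (g_{n'}(l,k) H_n(e,c))`. -/
def moment (H : 𝔼 → ∀ n : Fin N, Matrix (Fin (d n)) (Fin (d n)) ℂ) (n' n : Fin N)
    (l k : Fin (d n')) (e c : Fin (d n)) : ℂ :=
  ∫ X, gMat X n' l k * H X n e c ∂γ

lemma meanMat_mul_left {H : 𝔼 → ∀ n : Fin N, Matrix (Fin (d n)) (Fin (d n)) ℂ}
    (hH : ∀ n i j, MemLp (fun X => H X n i j) 2 γ) {n : Fin N}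
    (A : Matrix (Fin (d n)) (Fin (d n)) ℂ) (a c : Fin (d n)) (h : sqInt (CoordIndex d N))
    (hh : ∀ X, h.1 X = (A * H X n) a c) (n' : Fin N) (l k : Fin (d n')) :
    meanMat h n' l k = ∑ e, A a e * moment H n' n l k e c := by
  have : ∀ X, gMat X n' l k * h.1 X = ∑ e, A a e * (gMat X n' l k * H X n e c) := fun X => by
    rw [hh, Matrix.mul_apply, Finset.mul_sum]
    exact Finset.sum_congr rfl fun e _ => by ring
  simp only [meanMat, Matrix.of_apply, this, moment]
  have hi : ∀ e, Integrable (fun X => gMat X n' l k * H X n e c) γ := fun e =>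
    (memLp_gMat n' l k).integrable_mul (hH n e c)
  rw [integral_finsetSum _ fun e _ => (hi e).const_mul (A a e)]
  exact Finset.sum_congr rfl fun e _ => integral_const_mul _ _

/-- The coefficients in the expansion of the averaged Gaussian form. -/
lemma sum_meanForm_expand {H H' : 𝔼 → ∀ n : Fin N, Matrix (Fin (d n)) (Fin (d n)) ℂ}
    (hH : ∀ n i j, MemLp (fun X => H X n i j) 2 γ) (hH' : ∀ n i j, MemLp (fun X => H' X n i j) 2 γ)
    (x p q A B : ∀ n : Fin N, Matrix (Fin (d n)) (Fin (d n)) ℂ)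
    {h h' : ∀ n : Fin N, Fin (d n) → Fin (d n) → sqInt (CoordIndex d N)}
    (hh : ∀ n a c X, (h n a c).1 X = (A n * H X n) a c)
    (hh' : ∀ n a c X, (h' n a c).1 X = (B n * H' X n) a c) :
    ∑ n : Fin N, (d n : ℂ) * ∑ a, ∑ b, ∑ c, x n b a * meanForm p q (h n a c) (h' n c b) =
      ∑ n : Fin N, ∑ a, ∑ b, ∑ c, ∑ n' : Fin N, ∑ l, ∑ j, ∑ i, ∑ k, ∑ e, ∑ f,
        ((d n : ℂ) * x n b a * d n' * moment H n' n l k e c * moment H' n' n i j f b) *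
          ((A n a e * star (p n' i k)) * (B n c f * star (q n' l j))) := by
  have hs : ∀ {K : Type} [Fintype K] (u v : K → ℂ) (r s : ℂ),
      (∑ e, u e) * r * (∑ f, v f) * s = ∑ e, ∑ f, u e * r * v f * s := by
    intro K _ u v r s
    simp only [Finset.sum_mul, Finset.mul_sum]
    exact Finset.sum_comm
  have h1 : ∀ n a b c, meanForm p q (h n a c) (h' n c b) =
      ∑ n' : Fin N, ∑ l, ∑ j, ∑ i, ∑ k, ∑ e, ∑ f,
        (d n' : ℂ) * (A n a e * moment H n' n l k e c * star (p n' i k) *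
          (B n c f * moment H' n' n i j f b) * star (q n' l j)) := by
    intro n a b c
    rw [meanForm_apply, traceForm]
    refine Finset.sum_congr rfl fun n' _ => ?_
    rw [trace_mul_four, Finset.mul_sum]
    refine Finset.sum_congr rfl fun l _ => ?_
    rw [Finset.mul_sum]
    refine Finset.sum_congr rfl fun j _ => ?_
    rw [Finset.mul_sum]
    refine Finset.sum_congr rfl fun i _ => ?_
    rw [Finset.mul_sum]
    refine Finset.sum_congr rfl fun k _ => ?_
    rw [meanMat_mul_left hH _ _ _ _ (hh n a c), meanMat_mul_left hH' _ _ _ _ (hh' n c b),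
      Matrix.conjTranspose_apply, Matrix.conjTranspose_apply, hs, Finset.mul_sum]
    exact Finset.sum_congr rfl fun e _ => Finset.mul_sum _ _ _
  refine Finset.sum_congr rfl fun n _ => ?_
  rw [Finset.mul_sum]
  refine Finset.sum_congr rfl fun a _ => ?_
  rw [Finset.mul_sum]
  refine Finset.sum_congr rfl fun b _ => ?_
  rw [Finset.mul_sum]
  refine Finset.sum_congr rfl fun c _ => ?_
  rw [h1]
  simp only [Finset.mul_sum]
  refine Finset.sum_congr rfl
    fun n' _ => Finset.sum_congr rfl
    fun l _ => Finset.sum_congr rfl fun j _ => Finset.sum_congr rfl fun i _ => Finset.sum_congr rfl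
    fun k _ => Finset.sum_congr rfl fun e _ => Finset.sum_congr rfl fun f _ => ?_
  ring

end Biorthogonality

/-! ### Averaging over `s` and `s'` by biorthogonality. -/

section Averaging

open scoped Matrix

variable {T : Type*} [MeasurableSpace T] {m : Measure T}

lemma integral_integral_sum_mul {Θ : Type*} [Fintype Θ] (K : Θ → ℂ) {u v : Θ → T → ℂ}
    (hu : ∀ θ, Integrable (u θ) m) (hv : ∀ θ, Integrable (v θ) m) :
    ∫ s, ∫ s', ∑ θ, K θ * (u θ s * v θ s') ∂m ∂m = ∑ θ, K θ * ((∫ s, u θ s ∂m) * ∫ s, v θ s ∂m) := by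
  have h1 : ∀ s, ∫ s', ∑ θ, K θ * (u θ s * v θ s') ∂m = ∑ θ, K θ * (u θ s * ∫ s', v θ s' ∂m) := by
    intro s
    rw [integral_finsetSum _ fun θ _ => ((hv θ).const_mul _).const_mul _]
    simp only [integral_const_mul]
  simp only [h1]
  rw [integral_finsetSum _ fun θ _ => ((hu θ).mul_const _).const_mul _]
  simp only [integral_const_mul, integral_mul_const]

lemma sum_six_collapse {n : ℕ} (K : Fin n → Fin n → Fin n → Fin n → Fin n → Fin n → ℂ) (D : ℂ)
    (a c : Fin n) :
    ∑ l, ∑ j, ∑ i, ∑ k, ∑ e, ∑ f, K l j i k e f *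
      ((if i = a ∧ k = e then D else 0) * (if l = c ∧ j = f then D else 0)) =
      ∑ j, ∑ k, K c j a k k j * (D * D) := by
  rw [Finset.sum_eq_single c (fun l _ hl => by simp [hl]) (by simp)]
  refine Finset.sum_congr rfl fun j _ => ?_
  rw [Finset.sum_eq_single a (fun i _ hi => by simp [hi]) (by simp)]
  refine Finset.sum_congr rfl fun k _ => ?_
  rw [Finset.sum_eq_single k (fun e _ he => by simp [he.symm]) (by simp),
    Finset.sum_eq_single j (fun f _ hf => by simp [hf.symm]) (by simp)]
  simp

variable {d : ℕ → ℕ} {N : ℕ}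
  {φ ψ : ∀ n, T → Matrix (Fin (d n)) (Fin (d n)) ℂ}

local notation "𝔼" => EuclideanSpace ℝ (CoordIndex d N)
local notation "γ" => stdGaussian (EuclideanSpace ℝ (CoordIndex d N))

lemma UniformlyBounded.integrable_entry_mul_star (hφ : UniformlyBounded m φ)
    [IsFiniteMeasure m] (hψ : UniformlyBounded m ψ) (n n' : ℕ) (a e : Fin (d n)) (i k : Fin (d n')) :
    Integrable (fun s => ψ n s a e * star (φ n' s i k)) m := by
  obtain ⟨hφm, c, hc⟩ := hφ
  obtain ⟨hψm, c', hc'⟩ := hψ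
  refine Integrable.of_bound ((hψm n a e).mul (hφm n' i k).star) (|c'| * |c|) ?_
  filter_upwards [hc n', hc' n] with s h1 h2
  rw [norm_mul, norm_star]
  exact mul_le_mul (((norm_entry_le_opNorm _ _ _).trans h2).trans (le_abs_self _))
    (((norm_entry_le_opNorm _ _ _).trans h1).trans (le_abs_self _)) (norm_nonneg _) (abs_nonneg _)

lemma integral_entry_mul_star (φ ψ : ∀ n, T → Matrix (Fin (d n)) (Fin (d n)) ℂ) (n n' : ℕ)
    (a e : Fin (d n)) (i k : Fin (d n')) :
    ∫ s, ψ n s a e * star (φ n' s i k) ∂m =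
      (starRingEnd ℂ) (∫ s, φ n' s i k * (starRingEnd ℂ) (ψ n s a e) ∂m) := by
  rw [← integral_conj]
  refine integral_congr_ae (.of_forall fun s => ?_)
  simp [mul_comm]

/-- The index set of the expansion of the averaged Gaussian form. -/
abbrev ExpansionIndex (d : ℕ → ℕ) (N : ℕ) : Type :=
  Σ n : Fin N, Fin (d n) × Fin (d n) × Fin (d n) × (Σ n' : Fin N,
    Fin (d n') × Fin (d n') × Fin (d n') × Fin (d n') × Fin (d n) × Fin (d n))

lemma sum_expansionIndex (F : ∀ n : Fin N, Fin (d n) → Fin (d n) → Fin (d n) → ∀ n' : Fin N,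
    Fin (d n') → Fin (d n') → Fin (d n') → Fin (d n') → Fin (d n) → Fin (d n) → ℂ) :
    ∑ n : Fin N, ∑ a, ∑ b, ∑ c, ∑ n' : Fin N, ∑ l, ∑ j, ∑ i, ∑ k, ∑ e, ∑ f,
      F n a b c n' l j i k e f = ∑ θ : ExpansionIndex d N,
        F θ.1 θ.2.1 θ.2.2.1 θ.2.2.2.1 θ.2.2.2.2.1 θ.2.2.2.2.2.1 θ.2.2.2.2.2.2.1 θ.2.2.2.2.2.2.2.1
          θ.2.2.2.2.2.2.2.2.1 θ.2.2.2.2.2.2.2.2.2.1 θ.2.2.2.2.2.2.2.2.2.2 := by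
  simp only [Fintype.sum_sigma, Fintype.sum_prod_type]

/-- Blocks with `n' ≠ n` integrate to zero, and on the diagonal the two factors `d_n⁻¹` cancel `d_n
d_{n'}`. The Kronecker symbols separate what is left into `tr(𝔼 g_n H_n) · tr(x_n 𝔼(g_n H'_n))`. -/
lemma NormalizedBiorthogonal.integral_sum_eq [IsFiniteMeasure m] (hφ : UniformlyBounded m φ)
    (hψ : UniformlyBounded m ψ) (hφψ : NormalizedBiorthogonal m φ ψ)
    (H H' : 𝔼 → ∀ n : Fin N, Matrix (Fin (d n)) (Fin (d n)) ℂ)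
    (x : ∀ n : Fin N, Matrix (Fin (d n)) (Fin (d n)) ℂ) :
    ∫ s, ∫ s', ∑ n : Fin N, ∑ a, ∑ b, ∑ c, ∑ n' : Fin N, ∑ l, ∑ j, ∑ i, ∑ k, ∑ e, ∑ f,
        ((d n : ℂ) * x n b a * d n' * moment H n' n l k e c * moment H' n' n i j f b) *
          ((ψ n s a e * star (φ n' s i k)) * (ψ n s' c f * star (φ n' s' l j))) ∂m ∂m =
      ∑ n : Fin N, (∑ c, ∑ k, moment H n n c k k c) *
        ∑ b, ∑ a, ∑ j, x n b a * moment H' n n a j j b := by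
  have h1 := integral_integral_sum_mul (m := m) (Θ := ExpansionIndex d N)
    (fun θ => (d θ.1 : ℂ) * x θ.1 θ.2.2.1 θ.2.1 * d θ.2.2.2.2.1 *
      moment H θ.2.2.2.2.1 θ.1 θ.2.2.2.2.2.1 θ.2.2.2.2.2.2.2.2.1 θ.2.2.2.2.2.2.2.2.2.1 θ.2.2.2.1 *
      moment H' θ.2.2.2.2.1 θ.1 θ.2.2.2.2.2.2.2.1 θ.2.2.2.2.2.2.1 θ.2.2.2.2.2.2.2.2.2.2 θ.2.2.1)
    (fun θ => hφ.integrable_entry_mul_star hψ θ.1 θ.2.2.2.2.1 θ.2.1 θ.2.2.2.2.2.2.2.2.2.1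
      θ.2.2.2.2.2.2.2.1 θ.2.2.2.2.2.2.2.2.1)
    (fun θ => hφ.integrable_entry_mul_star hψ θ.1 θ.2.2.2.2.1 θ.2.2.2.1 θ.2.2.2.2.2.2.2.2.2.2
      θ.2.2.2.2.2.1 θ.2.2.2.2.2.2.1)
  have e1 := fun s s' => sum_expansionIndex fun n a b c n' l j i k e f =>
    ((d n : ℂ) * x n b a * d n' * moment H n' n l k e c * moment H' n' n i j f b) *
      ((ψ n s a e * star (φ n' s i k)) * (ψ n s' c f * star (φ n' s' l j)))
  have e2 := sum_expansionIndex fun n a b c n' l j i k e f =>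
    ((d n : ℂ) * x n b a * d n' * moment H n' n l k e c * moment H' n' n i j f b) *
      ((∫ s, ψ n s a e * star (φ n' s i k) ∂m) * ∫ s, ψ n s c f * star (φ n' s l j) ∂m)
  -- The nested sums are packed into a single index so that Fubini for finite sums of products is
  -- used once, then unpacked.
  refine (integral_congr_ae (.of_forall fun s => integral_congr_ae (.of_forall fun s' =>
    e1 s s'))).trans (h1.trans (e2.symm.trans ?_))
  refine Finset.sum_congr rfl fun n _ => ?_
  have h2 : ∀ a b c : Fin (d n), ∑ n' : Fin N, ∑ l, ∑ j, ∑ i, ∑ k, ∑ e, ∑ f,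
      ((d n : ℂ) * x n b a * d n' * moment H n' n l k e c * moment H' n' n i j f b) *
        ((∫ s, ψ n s a e * star (φ n' s i k) ∂m) * ∫ s, ψ n s c f * star (φ n' s l j) ∂m) =
      ∑ j, ∑ k, x n b a * moment H n n c k k c * moment H' n n a j j b := by
    intro a b c
    rw [Finset.sum_eq_single n]
    · have hd : (d n : ℂ) ≠ 0 := by exact_mod_cast a.pos.ne'
      have h3 : ∀ a e i k : Fin (d n), ∫ s, ψ n s a e * star (φ n s i k) ∂m =
          if i = a ∧ k = e then (d n : ℂ)⁻¹ else 0 := fun a e i k => by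
        rw [integral_entry_mul_star, hφψ.2]
        split_ifs <;> simp
      simp only [h3]
      rw [sum_six_collapse (fun l j i k e f => (d n : ℂ) * x n b a * d n * moment H n n l k e c *
        moment H' n n i j f b)]
      refine Finset.sum_congr rfl fun j _ => Finset.sum_congr rfl fun k _ => ?_
      field_simp
    · intro n' _ hn
      have h3 : ∀ a e i k, ∫ s, ψ n s a e * star (φ n' s i k) ∂m = 0 := fun a e i k => by
        rw [integral_entry_mul_star, hφψ.1 n' n (fun h => hn (Fin.ext h)), map_zero]
      simp only [h3, mul_zero, Finset.sum_const_zero]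
    · simp
  calc _ = ∑ a, ∑ b, ∑ c, ∑ j, ∑ k, x n b a * moment H n n c k k c * moment H' n n a j j b :=
        Finset.sum_congr rfl fun a _ => Finset.sum_congr rfl fun b _ =>
          Finset.sum_congr rfl fun c _ => h2 a b c
    _ = ∑ a, ∑ b, (∑ c, ∑ k, moment H n n c k k c) * ∑ j, x n b a * moment H' n n a j j b := by
        refine Finset.sum_congr rfl fun a _ => Finset.sum_congr rfl fun b _ => ?_
        rw [Finset.sum_mul]
        refine Finset.sum_congr rfl fun c _ => ?_
        rw [Finset.sum_mul_sum, Finset.sum_comm]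
        exact Finset.sum_congr rfl fun k _ => Finset.sum_congr rfl fun j _ => by ring
    _ = _ := by
        rw [Finset.sum_comm]
        simp only [← Finset.mul_sum]

end Averaging

/-! ### Four factors. -/

section SidonDotPower

open scoped Matrix

variable {T : Type*} {d : ℕ → ℕ} {φ ψ : ∀ n, T → Matrix (Fin (d n)) (Fin (d n)) ℂ}

lemma dotPower_four (n : ℕ) (s t s' t' : T) :
    dotPower 4 ψ n ![s, t, s', t'] = ψ n s * ψ n t * ψ n s' * ψ n t' := by
  simp [dotPower, List.ofFn_succ, mul_assoc]

/-- To show that a system is Sidon, it is enough to bound the trace norms by any almost everywhere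
bound of the trigonometric polynomial. -/
lemma SidonWith.of_ae_bound {Ω : Type*} [MeasurableSpace Ω] {μ : Measure Ω}
    {θ : ∀ n, Ω → Matrix (Fin (d n)) (Fin (d n)) ℂ} {α : ℝ≥0} (hα : α ≠ 0)
    (h : ∀ (N : ℕ) (x : ∀ n, Matrix (Fin (d n)) (Fin (d n)) ℂ) (M : ℝ), 0 ≤ M →
      (∀ᵐ t ∂μ, ‖∑ n : Fin N, (d n : ℂ) * (x n * θ n t).trace‖ ≤ M) →
      ∑ n : Fin N, (d n : ℝ) * traceNorm (x n) ≤ α * M) : SidonWith μ θ α := by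
  intro N x
  simp only [Finset.sum_range]
  set f := fun t => ∑ n : Fin N, (d n : ℂ) * (x n * θ n t).trace
  rcases eq_or_ne (eLpNorm f ∞ μ) ∞ with hf | hf
  -- `α ≠ 0` matters here, since `0 * ∞ = 0`.
  · rw [hf, ENNReal.mul_top (by exact_mod_cast hα)]
    exact le_top
  · have h1 : ∀ᵐ t ∂μ, ‖f t‖ ≤ (eLpNorm f ∞ μ).toReal := by
      rw [eLpNorm_exponent_top] at hf ⊢
      filter_upwards [ae_le_eLpNormEssSup (f := f) (μ := μ)] with t ht
      rw [← toReal_enorm]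
      exact ENNReal.toReal_mono hf ht
    refine (ENNReal.ofReal_le_ofReal (h N x _ ENNReal.toReal_nonneg h1)).trans_eq ?_
    rw [ENNReal.ofReal_mul (NNReal.coe_nonneg α), ENNReal.ofReal_toReal hf,
      ENNReal.ofReal_coe_nnreal]

lemma SidonWith.sum_le_of_ae_bound {Ω : Type*} [MeasurableSpace Ω] {μ : Measure Ω}
    {θ : ∀ n, Ω → Matrix (Fin (d n)) (Fin (d n)) ℂ} {α : ℝ≥0} (h : SidonWith μ θ α) {N : ℕ}
    (x : ∀ n, Matrix (Fin (d n)) (Fin (d n)) ℂ) {M : ℝ} (hM : 0 ≤ M)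
    (hx : ∀ᵐ t ∂μ, ‖∑ n : Fin N, (d n : ℂ) * (x n * θ n t).trace‖ ≤ M) :
    ∑ n : Fin N, (d n : ℝ) * traceNorm (x n) ≤ α * M := by
  have h1 := h N x
  simp only [Finset.sum_range] at h1
  have h2 : eLpNorm (fun t => ∑ n : Fin N, (d n : ℂ) * (x n * θ n t).trace) ∞ μ ≤
      ENNReal.ofReal M := by
    rw [eLpNorm_exponent_top]
    refine eLpNormEssSup_le_of_ae_bound hx
  have h3 := h1.trans (mul_le_mul_right h2 _)
  rw [← ENNReal.ofReal_coe_nnreal, ← ENNReal.ofReal_mul (NNReal.coe_nonneg α),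
    ENNReal.ofReal_le_ofReal_iff (by positivity)] at h3
  exact h3

lemma sum_smul_one_mul {n : ℕ} (c : ℂ) (F : Fin n → Fin n → Fin n → ℂ) :
    ∑ a, ∑ i, ∑ k, (c • (1 : Matrix (Fin n) (Fin n) ℂ)) a i * F a i k = c * ∑ a, ∑ k, F a a k := by
  rw [Finset.mul_sum]
  refine Finset.sum_congr rfl fun a _ => ?_
  rw [Finset.sum_eq_single a (fun i _ hi => by simp [hi.symm]) (by simp), Finset.mul_sum]
  simp

variable [MeasurableSpace T] {m : Measure T}

lemma UniformlyBounded.exists_common_bound (hφ : UniformlyBounded m φ)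
    (hψ : UniformlyBounded m ψ) : ∃ κ : ℝ, 1 ≤ κ ∧ (∀ᵐ t ∂m, ∀ n, opNorm (φ n t) ≤ κ) ∧
      ∀ᵐ t ∂m, ∀ n, opNorm (ψ n t) ≤ κ := by
  obtain ⟨-, c, hc⟩ := hφ
  obtain ⟨-, c', hc'⟩ := hψ
  refine ⟨max 1 (max c c'), le_max_left _ _, ?_, ?_⟩
  · filter_upwards [ae_all_iff.2 hc] with t ht n
    exact (ht n).trans ((le_max_left _ _).trans (le_max_right _ _))
  · filter_upwards [ae_all_iff.2 hc'] with t ht n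
    exact (ht n).trans ((le_max_right _ _).trans (le_max_right _ _))

variable {N : ℕ} {e : ∀ n, Fin (d n) → Fin (d n) → Lp ℂ ∞ m}

local notation "𝔼" => EuclideanSpace ℝ (CoordIndex d N)
local notation "γ" => stdGaussian (EuclideanSpace ℝ (CoordIndex d N))

lemma memLp_dualMat {ℓ : 𝔼 → StrongDual ℂ (Lp ℂ ∞ m)} (hℓ : ∀ X, ‖ℓ X‖ ≤ 1)
    (hm : ∀ v, Measurable fun X => ℓ X v) (n : ℕ) (i j : Fin (d n)) :
    MemLp (fun X => dualMat e (ℓ X) n i j) 2 γ := by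
  refine MemLp.of_bound (hm (e n i j)).aestronglyMeasurable ‖e n i j‖ (.of_forall fun X => ?_)
  simpa [dualMat] using (ℓ X).le_of_opNorm_le (hℓ X) (e n i j)

lemma memLp_mul_dualMat {ℓ : 𝔼 → StrongDual ℂ (Lp ℂ ∞ m)} (hℓ : ∀ X, ‖ℓ X‖ ≤ 1)
    (hm : ∀ v, Measurable fun X => ℓ X v) {n : ℕ} (a : Matrix (Fin (d n)) (Fin (d n)) ℂ)
    (i j : Fin (d n)) : MemLp (fun X => (a * dualMat e (ℓ X) n) i j) 2 γ := by
  simp only [Matrix.mul_apply]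
  exact memLp_finsetSum _ fun k _ => (memLp_dualMat hℓ hm n k j).const_mul _

variable [IsProbabilityMeasure m]

/-- The slices of a bounded fourfold polynomial give a bound of the averaged moments. -/
lemma norm_sum_moment_le (hφ : UniformlyBounded m φ) (hψ : UniformlyBounded m ψ)
    (hφψ : NormalizedBiorthogonal m φ ψ)
    (he : ∀ n, ∀ᵐ t ∂m, ∀ i j, e n i j t = ψ n t i j) {κ : ℝ} (hκ : 0 < κ)
    (hφκ : ∀ᵐ t ∂m, ∀ n, opNorm (φ n t) ≤ κ) (hψκ : ∀ᵐ t ∂m, ∀ n, opNorm (ψ n t) ≤ κ)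
    (x : ∀ n : Fin N, Matrix (Fin (d n)) (Fin (d n)) ℂ) {M : ℝ} (hM : 0 ≤ M)
    (h : ∀ᵐ t ∂(Measure.pi fun _ : Fin 4 => m),
      ‖∑ n : Fin N, (d n : ℂ) * (x n * dotPower 4 ψ n t).trace‖ ≤ M)
    {ℓ ℓ' : 𝔼 → StrongDual ℂ (Lp ℂ ∞ m)} (hℓ : ∀ X, ‖ℓ X‖ ≤ 1) (hℓ' : ∀ X, ‖ℓ' X‖ ≤ 1)
    (hm : ∀ v, Measurable fun X => ℓ X v) (hm' : ∀ v, Measurable fun X => ℓ' X v)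
    {ε : ℝ} (h0 : 0 < ε) (h1 : ε ≤ 1) :
    ‖∑ n : Fin N, (∑ c, ∑ k, moment (fun X n => dualMat e (ℓ X) n) n n c k k c) *
        ∑ b, ∑ a, ∑ j, x n b a * moment (fun X n => dualMat e (ℓ' X) n) n n a j j b‖ ≤
      2 * κ ^ 2 / ε * M +
        2 * κ ^ 2 * (κ * κ) ^ 2 * ε ^ 2 * ∑ n : Fin N, (d n : ℝ) * traceNorm (x n) := by
  have hopn : ∀ n {l : StrongDual ℂ (Lp ℂ ∞ m)}, ‖l‖ ≤ 1 → opNorm (dualMat e l n) ≤ κ :=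
    fun n _ hl => opNorm_dualMat_le he hκ.le (by filter_upwards [hψκ] with t ht using ht n) hl
  rw [← NormalizedBiorthogonal.integral_sum_eq hφ hψ hφψ]
  refine (norm_integral_le_of_norm_le_const ?_).trans_eq (by rw [probReal_univ, mul_one])
  filter_upwards [ae_pi_four h, hφκ, hψκ] with s hs hφs hψs
  refine (norm_integral_le_of_norm_le_const ?_).trans_eq (by rw [probReal_univ, mul_one])
  filter_upwards [hs, hφκ, hψκ] with s' hs' hφs' hψs'
  simp only [dotPower_four] at hs'
  -- For fixed `s, s'` the integrand is the Gaussian form with `p = φ(s)`, `q = φ(s')`, `A = ψ(s) H`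
  -- and `A' = ψ(s') H'`. The last two are bounded by `κ · κ`.
  rw [← sum_meanForm_expand (fun n => memLp_dualMat hℓ hm n) (fun n => memLp_dualMat hℓ' hm' n)
    x (fun n => φ n s) (fun n => φ n s') (fun n => ψ n s) (fun n => ψ n s')
    (h := fun n a c => ⟨fun X => (ψ n s * dualMat e (ℓ X) n) a c, memLp_mul_dualMat hℓ hm _ a c⟩)
    (h' := fun n a c =>
      ⟨fun X => (ψ n s' * dualMat e (ℓ' X) n) a c, memLp_mul_dualMat hℓ' hm' _ a c⟩)
    (fun _ _ _ _ => rfl) (fun _ _ _ _ => rfl)]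
  refine norm_sum_meanForm_le hκ (fun n => hφs n) (fun n => hφs' n) h0 h1 x
    (A := fun X n => ψ n s * dualMat e (ℓ X) n) (A' := fun X n => ψ n s' * dualMat e (ℓ' X) n)
    (fun X n => ?_) (fun X n => ?_) (fun _ _ _ _ => rfl) (fun _ _ _ _ => rfl) (fun X Y => ?_)
  · exact (opNorm_mul_le _ _).trans
      (mul_le_mul (hψs n) (hopn n (hℓ X)) (opNorm_nonneg _) hκ.le)
  · exact (opNorm_mul_le _ _).trans
      (mul_le_mul (hψs' n) (hopn n (hℓ' X)) (opNorm_nonneg _) hκ.le)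
  · exact norm_sum_trace_pair_le he x (fun n => ψ n s) (fun n => ψ n s') hM hs' (hℓ X) (hℓ' Y)

/-- A randomly Sidon system is `⊗̇⁴`-Sidon. -/
theorem RandomlySidon.dotTensorSidon_four (hφ : UniformlyBounded m φ)
    (hψ : UniformlyBounded m ψ) (hφψ : NormalizedBiorthogonal m φ ψ) (hrs : RandomlySidon m ψ) :
    DotTensorSidon 4 m ψ := by
  obtain ⟨C, hC⟩ := hrs
  obtain ⟨κ, hκ1, hφκ, hψκ⟩ := hφ.exists_common_bound hψ
  obtain ⟨e, he⟩ := exists_entryLp hψ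
  have hκ : 0 < κ := by linarith
  have hC1 : (1 : ℝ) ≤ C + 1 := by have := C.2; simp
  have hα : 0 < 64 * (C + 1 : ℝ) ^ 3 * κ ^ 5 := by positivity
  refine ⟨⟨64 * (C + 1 : ℝ) ^ 3 * κ ^ 5, hα.le⟩,
    SidonWith.of_ae_bound (fun h => hα.ne' (congrArg NNReal.toReal h)) fun N x M hM hx => ?_⟩
  obtain ⟨ℓ', hℓ', hm', hn'⟩ := hC.exists_norming he N fun n => x n
  set w : Fin N → ℂ := fun n => ∑ b, ∑ a, ∑ j, x n b a *
    moment (fun X n => dualMat e (ℓ' X) n) n n a j j b with hw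
  -- Second use of the randomly Sidon property, on scalar matrices: `tr|(w_n/d_n) 1|` is at least
  -- `|w_n|`, and the dual side gives `τ_n w_n` after multiplication by `d_n`.
  obtain ⟨ℓ, hℓ, hm, hn⟩ := hC.exists_norming he N fun n =>
    (w n / d n) • (1 : Matrix (Fin (d n)) (Fin (d n)) ℂ)
  set τ : Fin N → ℂ := fun n => ∑ c, ∑ k, moment (fun X n => dualMat e (ℓ X) n) n n c k k c
  set S := ∑ n : Fin N, (d n : ℝ) * traceNorm (x n)
  have hS0 : 0 ≤ S := Finset.sum_nonneg fun n _ =>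
    mul_nonneg (Nat.cast_nonneg _) (traceNorm_nonneg _)
  -- Empty blocks contribute nothing, so division by `d_n = 0` is harmless.
  have hw0 : ∀ n : Fin N, (d n : ℂ) = 0 → w n = 0 := fun n h => by
    have : IsEmpty (Fin (d n)) := by rw [Nat.cast_eq_zero.1 h]; infer_instance
    simp [hw]
  have a1 : S ≤ 2 * C * ∑ n : Fin N, (d n : ℝ) * ‖w n‖ := by
    refine hn'.trans (mul_le_mul_of_nonneg_left ?_ (by positivity))
    refine (Complex.re_le_norm _).trans ((norm_sum_le _ _).trans (Finset.sum_le_sum fun n _ => ?_))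
    rw [norm_mul, Complex.norm_natCast]
    exact le_rfl
  have a2 : ∑ n : Fin N, (d n : ℝ) * ‖w n‖ ≤ 2 * C * ‖∑ n, τ n * w n‖ := by
    refine le_trans (Finset.sum_le_sum fun n _ => ?_) (hn.trans
      (mul_le_mul_of_nonneg_left ((Complex.re_le_norm _).trans_eq (congrArg norm ?_))
      (by positivity)))
    · refine mul_le_mul_of_nonneg_left ?_ (Nat.cast_nonneg _)
      refine le_trans (le_of_eq ?_) (norm_trace_le_traceNorm _)
      rw [Matrix.trace_smul, Matrix.trace_one, Fintype.card_fin, smul_eq_mul]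
      rcases eq_or_ne (d n : ℂ) 0 with h | h
      · rw [hw0 n h, h, mul_zero]
      · rw [div_mul_cancel₀ _ h]
    · refine Finset.sum_congr rfl fun n _ => ?_
      refine (congrArg _ (sum_smul_one_mul (w n / d n) fun a i k =>
        moment (fun X n => dualMat e (ℓ X) n) n n i k k a)).trans ?_
      rcases eq_or_ne (d n : ℂ) 0 with h | h
      · rw [hw0 n h, h, mul_zero, zero_mul]
      · rw [← mul_assoc, mul_div_cancel₀ _ h, mul_comm]
  -- Replacing `C` by `C + 1 ≥ 1` keeps `ε` defined when `C = 0` and ensures `ε ≤ 1`.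
  set D : ℝ := C + 1
  have hD : 0 < D := by linarith
  have hCD : (C : ℝ) ≤ D := by simp [D]
  -- Chosen so that the error `4D² · 2κ⁶ε² S` equals `S/2`. The main term is then `32 D³κ⁵ M`, which
  -- doubles to the constant `64 D³κ⁵`.
  set ε : ℝ := 1 / (4 * D * κ ^ 3)
  have hκ3 : 1 ≤ κ ^ 3 := one_le_pow₀ hκ1
  have hε0 : 0 < ε := by positivity
  have hε1 : ε ≤ 1 := by
    rw [div_le_one (by positivity)]
    nlinarith
  have a3 := norm_sum_moment_le hφ hψ hφψ he hκ hφκ hψκ (fun n : Fin N => x n) hM hx hℓ hℓ' hm hm'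
    hε0 hε1
  have e1 : 2 * κ ^ 2 / ε * M = 8 * D * κ ^ 5 * M := by
    simp only [ε]; field_simp; ring
  have e2 : 2 * κ ^ 2 * (κ * κ) ^ 2 * ε ^ 2 = 1 / (8 * D ^ 2) := by
    simp only [ε]; field_simp; ring
  rw [e1, e2] at a3
  have a4 : S ≤ 4 * D ^ 2 * (8 * D * κ ^ 5 * M + 1 / (8 * D ^ 2) * S) := by
    refine (a1.trans (mul_le_mul_of_nonneg_left a2 (by positivity))).trans ?_
    rw [← mul_assoc]
    refine mul_le_mul ?_ a3 (norm_nonneg _) (by positivity)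
    nlinarith [C.2]
  have e3 : 4 * D ^ 2 * (8 * D * κ ^ 5 * M + 1 / (8 * D ^ 2) * S) =
      32 * D ^ 3 * κ ^ 5 * M + S / 2 := by
    field_simp; ring
  rw [e3] at a4
  change S ≤ 64 * D ^ 3 * κ ^ 5 * M
  linarith

end SidonDotPower

/-! ### Adding one more factor. -/

section SidonInduction

open scoped Matrix

variable {T : Type*} {d : ℕ → ℕ} {φ ψ : ∀ n, T → Matrix (Fin (d n)) (Fin (d n)) ℂ}

lemma dotPower_insertNth_last (k n : ℕ) (a : T) (t : Fin k → T) :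
    dotPower (k + 1) ψ n ((Fin.last k).insertNth a t) = dotPower k ψ n t * ψ n a := by
  rw [dotPower, List.ofFn_succ', List.concat_eq_append, List.prod_append]
  simp [dotPower, Fin.insertNth_last']

lemma trace_mul_conjTranspose_mul_mul {n : ℕ} (u p q x : Matrix (Fin n) (Fin n) ℂ) :
    (u * (pᴴ * q * x)).trace = ∑ a, ∑ i, ∑ j, ∑ l, u a i * x j a * (q l j * star (p l i)) := by
  simp only [Matrix.trace, Matrix.diag_apply, Matrix.mul_apply, Finset.sum_mul, Finset.mul_sum,
    Matrix.conjTranspose_apply]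
  refine Finset.sum_congr rfl fun a _ => Finset.sum_congr rfl fun i _ =>
    Finset.sum_congr rfl fun j _ => Finset.sum_congr rfl fun l _ => ?_
  ring

variable [MeasurableSpace T] {m : Measure T} [IsProbabilityMeasure m]

lemma UniformlyBounded.integrable_trace (hφ : UniformlyBounded m φ) (hψ : UniformlyBounded m ψ)
    (n : ℕ) (u x : Matrix (Fin (d n)) (Fin (d n)) ℂ) :
    Integrable (fun t => (u * ((φ n t)ᴴ * ψ n t * x)).trace) m := by
  simp only [trace_mul_conjTranspose_mul_mul]
  exact integrable_finsetSum _ fun a _ => integrable_finsetSum _ fun i _ =>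
    integrable_finsetSum _ fun j _ => integrable_finsetSum _ fun l _ =>
    (hφ.integrable_entry_mul_star hψ n n l j l i).const_mul _

/-- Summing the biorthogonality relation over the row index gives `∫ φ_n^* ψ_n dm = 1`: the `d_n`
terms `d_n⁻¹` add up to one. -/
lemma NormalizedBiorthogonal.integral_trace (hφ : UniformlyBounded m φ)
    (hψ : UniformlyBounded m ψ) (hφψ : NormalizedBiorthogonal m φ ψ) (n : ℕ)
    (u x : Matrix (Fin (d n)) (Fin (d n)) ℂ) :
    ∫ t, (u * ((φ n t)ᴴ * ψ n t * x)).trace ∂m = (u * x).trace := by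
  have hi := fun a i j l : Fin (d n) =>
    (hφ.integrable_entry_mul_star hψ n n l j l i).const_mul (u a i * x j a)
  simp only [trace_mul_conjTranspose_mul_mul]
  rw [integral_finsetSum _ fun a _ => integrable_finsetSum _ fun i _ =>
    integrable_finsetSum _ fun j _ => integrable_finsetSum _ fun l _ => hi a i j l]
  simp only [Matrix.trace, Matrix.diag_apply, Matrix.mul_apply]
  refine Finset.sum_congr rfl fun a _ => ?_
  have hd : (d n : ℂ) ≠ 0 := by exact_mod_cast a.pos.ne'
  rw [integral_finsetSum _ fun i _ =>
    integrable_finsetSum _ fun j _ => integrable_finsetSum _ fun l _ => hi a i j l]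
  refine Finset.sum_congr rfl fun i _ => ?_
  rw [integral_finsetSum _ fun j _ => integrable_finsetSum _ fun l _ => hi a i j l,
    Finset.sum_eq_single i]
  · rw [integral_finsetSum _ fun l _ => hi a i i l]
    simp only [integral_const_mul, integral_entry_mul_star, hφψ.2]
    simp
    field_simp
  · intro j _ hj
    rw [integral_finsetSum _ fun l _ => hi a i j l]
    simp only [integral_const_mul, integral_entry_mul_star, hφψ.2]
    simp [hj.symm]
  · simp

/-- If `(ψ_n)` is `⊗̇ᵏ`-Sidon, then it is `⊗̇ᵏ⁺¹`-Sidon. -/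
theorem DotTensorSidon.succ (hφ : UniformlyBounded m φ)
    (hψ : UniformlyBounded m ψ) (hφψ : NormalizedBiorthogonal m φ ψ) {k : ℕ}
    (h : DotTensorSidon k m ψ) : DotTensorSidon (k + 1) m ψ := by
  obtain ⟨α, hα⟩ := h
  obtain ⟨κ, hκ1, hφκ, -⟩ := hφ.exists_common_bound hψ
  have hκ : 0 < κ := by linarith
  -- `α + 1` instead of `α` keeps the new constant nonzero.
  have hβ : 0 < κ * (α + 1 : ℝ) := by positivity
  refine ⟨⟨κ * (α + 1 : ℝ), hβ.le⟩,
    SidonWith.of_ae_bound (fun h => hβ.ne' (congrArg NNReal.toReal h)) fun N x M hM hx => ?_⟩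
  change _ ≤ κ * (α + 1 : ℝ) * M
  -- These contractions turn `S` into `∑ d_n tr(u_n x_n)`, the integral over `t` of `∑ d_n tr(u_n
  -- φ_n(t)^* ψ_n(t) x_n)`. For fixed `t` the integrand is at most `κ ∑ d_n tr|ψ_n(t) x_n|`.
  choose u hu1 hu using fun n => exists_trace_mul_eq_traceNorm (x n)
  have hb : ∀ᵐ t ∂m, ‖∑ n : Fin N, (d n : ℂ) * (u n * ((φ n t)ᴴ * ψ n t * x n)).trace‖ ≤
      κ * (α + 1 : ℝ) * M := by
    filter_upwards [ae_pi_insertNth hx (Fin.last k), hφκ] with t ht hφt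
    -- By cyclicity of the trace the last variable moves into the coefficient, so the hypothesis for
    -- `k` factors applies to `ψ_n(t) x_n`.
    have h1 : ∑ n : Fin N, (d n : ℝ) * traceNorm (ψ n t * x n) ≤ α * M := by
      refine hα.sum_le_of_ae_bound (fun n => ψ n t * x n) hM ?_
      filter_upwards [ht] with s hs
      simp only [dotPower_insertNth_last] at hs
      have : ∀ n : Fin N, (ψ n t * x n * dotPower k ψ n s).trace =
          (x n * (dotPower k ψ n s * ψ n t)).trace := fun n => by
        rw [mul_assoc, Matrix.trace_mul_comm, mul_assoc]
      simpa only [this] using hs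
    calc _ ≤ ∑ n : Fin N, κ * ((d n : ℝ) * traceNorm (ψ n t * x n)) := by
          refine (norm_sum_le _ _).trans (Finset.sum_le_sum fun n _ => ?_)
          rw [norm_mul, Complex.norm_natCast, mul_left_comm]
          refine mul_le_mul_of_nonneg_left ?_ (Nat.cast_nonneg _)
          rw [mul_assoc, ← mul_assoc, Matrix.trace_mul_comm, mul_comm κ]
          refine (norm_trace_mul_le _ _).trans
            (mul_le_mul_of_nonneg_left ?_ (traceNorm_nonneg _))
          refine (opNorm_mul_le _ _).trans ?_
          rw [opNorm_conjTranspose]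
          exact (mul_le_of_le_one_left (opNorm_nonneg _) (hu1 n)).trans (hφt n)
      _ ≤ κ * (α * M) := by
          rw [← Finset.mul_sum]
          exact mul_le_mul_of_nonneg_left h1 hκ.le
      _ ≤ _ := by nlinarith [mul_nonneg hκ.le hM]
  have hint := norm_integral_le_of_norm_le_const hb
  rw [probReal_univ, mul_one, integral_finsetSum _ fun (n : Fin N) _ =>
    (hφ.integrable_trace hψ n (u n) (x n)).const_mul (d n : ℂ)] at hint
  simp only [integral_const_mul, hφψ.integral_trace hφ hψ, hu] at hint
  refine le_trans (le_of_eq_of_le ?_ (Complex.re_le_norm _)) hint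
  rw [Complex.re_sum]
  exact Finset.sum_congr rfl fun n _ => by
    rw [← Complex.ofReal_natCast, ← Complex.ofReal_mul, Complex.ofReal_re]

end SidonInduction

end MatSidon

end

theorem mainTheorem5 {T : Type*} [MeasurableSpace T] (m : Measure T) [IsProbabilityMeasure m]
    (d : ℕ → ℕ) (φ ψ : ∀ n, T → Matrix (Fin (d n)) (Fin (d n)) ℂ)
    (hφ : MatSidon.UniformlyBounded m φ) (hψ : MatSidon.UniformlyBounded m ψ)
    (hφψ : MatSidon.NormalizedBiorthogonal m φ ψ)
    (hrs : MatSidon.RandomlySidon m ψ) :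
    ∀ k : ℕ, 4 ≤ k → MatSidon.DotTensorSidon k m ψ := by
  intro k hk
  induction k, hk using Nat.le_induction with
  | base => exact MatSidon.RandomlySidon.dotTensorSidon_four hφ hψ hφψ hrs
  | succ k _ ih => exact ih.succ hφ hψ hφψ
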